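/- Let $R\supseteq\mathbb{Q}$ be a commutative ring, $A$ a commutative unital $R$-algebra, and $E$ a finitely generated projective $A$-module with a symmetric $A$-bilinear form $\langle\cdot,\cdot\rangle\colon E\times E\to A$ that is strongly nondegenerate (the map $E\to\operatorname{Hom}_A(E,A)$, $x\mapsto\langle x,\cdot\rangle$, is bijective) and full (the induced map $E\otimes_A E\to A$ is surjective). Let $\nabla\colon\operatorname{Der}_R(A)\times E\to E$ be a metric connection, i.e. a biadditive map such that $$\nabla_{aD}x=a\nabla_Dx,\qquad \nabla_D(ax)=a\nabla_Dx+D(a)x,\qquad D\langle x,y\rangle=\langle\nabla_Dx,y\rangle+\langle x,\nabla_Dy\rangle .$$ Let $R(D,D')x=\nabla_D\nabla_{D'}x-\nabla_{D'}\nabla_Dx-\nabla_{[D,D']}x$ be its curvature, and let $r(D,D')\in\Lambda^2_AE$ be the unique element with $\langle r(D,D'),x\wedge y\rangle=\langle R(D,D')x,y\rangle$ for all $x,y\in E$, where $\langle u\wedge v,x\wedge y\rangle=\langle u,x\rangle\langle v,y\rangle-\langle v,x\rangle\langle u,y\rangle$. Let $$\mathcal{R}^\bullet(E)=\bigoplus_{n\ge0}\mathcal{R}^n(E),\qquad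 \mathcal{R}^n(E)=\bigoplus_{2p+k=n}\operatorname{Sym}^p_A\operatorname{Der}_R(A)\otimes_A\Lambda^k_AE,$$ be the Rothstein algebra, with product $(P\otimes\xi)\wedge(Q\otimes\eta)=(P\vee Q)\otimes(\xi\wedge\eta)$. Then there exists a unique graded Poisson structure of degree $-2$ on $\mathcal{R}^\bullet(E)$, i.e. an $R$-bilinear map $\{\cdot,\cdot\}$ such that for all $\phi\in\mathcal{R}^m(E)$, $\psi\in\mathcal{R}^n(E)$ and $\chi\in\mathcal{R}^\bullet(E)$ $$\{\phi,\psi\}\in\mathcal{R}^{m+n-2}(E)\ \ (\text{which is } 0 \text{ if } m+n<2),\qquad \{\phi,\psi\}=-(-1)^{mn}\{\psi,\phi\},$$ $$\{\phi,\psi\wedge\chi\}=\{\phi,\psi\}\wedge\chi+(-1)^{mn}\psi\wedge\{\phi,\chi\},\qquad \{\phi,\{\psi,\chi\}\}=\{\{\phi,\psi\},\chi\}+(-1)^{mn}\{\psi,\{\phi,\chi\}\},$$ with $$\{a,b\}=0=\{a,x\},\quad \{x,y\}=\langle x,y\rangle,\quad \{D,a\}=-D(a),\quad \{D,x\}=-\nabla_Dx,\quad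 \{D,D'\}=-[D,D']-r(D,D')$$ for all $a,b\in A=\mathcal{R}^0(E)$, $x,y\in E=\mathcal{R}^1(E)$ and $D,D'\in\operatorname{Der}_R(A)\subseteq\mathcal{R}^2(E)$. -/

import Mathlib

open scoped TensorProduct

noncomputable section

namespace Rothstein

section ExteriorSquare

variable {A E : Type*} [CommRing A] [AddCommGroup E] [Module A E]

/-- The pairing `⟨ω, x ∧ y⟩` of a 2-vector `ω` with `x ∧ y`, induced by a bilinear form `B`.
It is additive in `ω`, and `⟨u ∧ v, x ∧ y⟩ = ⟨u, x⟩⟨v, y⟩ - ⟨v, x⟩⟨u, y⟩`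
(see `wedgePairing_ιMulti`). -/
def wedgePairing (B : LinearMap.BilinForm A E) (ω : ⋀[A]^2 E) (x y : E) : A :=
  exteriorPower.pairingDual A E 2 (exteriorPower.map 2 (show E →ₗ[A] Module.Dual A E from B) ω)
    (exteriorPower.ιMulti A 2 ![x, y])

theorem wedgePairing_ιMulti (B : LinearMap.BilinForm A E) (u v x y : E) :
    wedgePairing B (exteriorPower.ιMulti A 2 ![u, v]) x y = B u x * B v y - B v x * B u y := by
  simp [wedgePairing, exteriorPower.map_apply_ιMulti, exteriorPower.pairingDual_ιMulti_ιMulti,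
    Matrix.det_fin_two]

/-- For a strongly nondegenerate symmetric form on a finitely generated projective module and a
skew-adjoint endomorphism `T` there is exactly one 2-vector `ω` with `⟨ω, x ∧ y⟩ = ⟨T x, y⟩`. -/
theorem existsUnique_twoVector [Module.Finite A E] [Module.Projective A E]
    (h2 : IsUnit (2 : A))
    (B : LinearMap.BilinForm A E) (hB : B.IsSymm)
    (hnd : Function.Bijective (B : E → Module.Dual A E))
    (T : E →ₗ[A] E) (hT : ∀ x y, B (T x) y = - B (T y) x) :
    ∃! ω : ⋀[A]^2 E, ∀ x y, wedgePairing B ω x y = B (T x) y := by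
  let := h2.invertible
  obtain ⟨n, f, g, -, -, hfg⟩ := Module.Finite.exists_comp_eq_id_of_projective A E
  set e : Fin n → E := fun i => f (Pi.single i 1) with he
  have hexp : ∀ x, ∑ i, g x i • e i = x := by
    intro x
    have h1 : f (g x) = x := by simpa using LinearMap.congr_fun hfg x
    conv_rhs => rw [← h1, pi_eq_sum_univ' (g x), map_sum]
    refine Finset.sum_congr rfl fun i _ => ?_
    rw [he, ← map_smul]
  choose w hw using fun i : Fin n => hnd.2 (LinearMap.proj i ∘ₗ g)
  have hw' : ∀ i x, B (w i) x = g x i := fun i x => LinearMap.congr_fun (hw i) x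
  have hw'' : ∀ i x, B x (w i) = g x i := fun i x => by
    rw [← hw' i x]; exact hB.eq x (w i)
  have hlin : ∀ x y, ∃ l : ⋀[A]^2 E →ₗ[A] A, ∀ ω, l ω = wedgePairing B ω x y := fun x y =>
    ⟨(LinearMap.applyₗ (exteriorPower.ιMulti A 2 ![x, y])) ∘ₗ
      (exteriorPower.pairingDual A E 2) ∘ₗ
        (exteriorPower.map 2 (show E →ₗ[A] Module.Dual A E from B)), fun ω => rfl⟩
  choose l hl using hlin
  have key : ∀ ω : ⋀[A]^2 E, ∑ i, ∑ j, wedgePairing B ω (w i) (w j) •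
      exteriorPower.ιMulti A 2 ![e i, e j] = (2 : A) • ω := by
    have hsum : ∀ u v : E, ∑ i, ∑ j, (g u i * g v j) • exteriorPower.ιMulti A 2 ![e i, e j] =
        exteriorPower.ιMulti A 2 ![u, v] := by
      intro u v
      have hL : ∀ v u : E, ∑ i, g u i • exteriorPower.ιMulti A 2 ![e i, v] =
          exteriorPower.ιMulti A 2 ![u, v] := by
        intro v u
        have hup : ∀ z : E, Function.update ![0, v] 0 z = ![z, v] := fun z => by
          ext i; fin_cases i <;> simp
        have := map_sum ((exteriorPower.ιMulti A 2 (M := E)).toMultilinearMap.toLinearMap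
          ![0, v] 0) (fun i => g u i • e i) Finset.univ
        rw [hexp] at this
        simpa [hup] using this.symm
      have hR : ∀ v u : E, ∑ j, g v j • exteriorPower.ιMulti A 2 ![u, e j] =
          exteriorPower.ιMulti A 2 ![u, v] := by
        intro v u
        have hup : ∀ z : E, Function.update ![u, 0] 1 z = ![u, z] := fun z => by
          ext i; fin_cases i <;> simp
        have := map_sum ((exteriorPower.ιMulti A 2 (M := E)).toMultilinearMap.toLinearMap
          ![u, 0] 1) (fun i => g v i • e i) Finset.univ
        rw [hexp] at this
        simpa [hup] using this.symm
      simp only [mul_smul, ← Finset.smul_sum, hR, hL]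
    have hext : ∑ i, ∑ j, (l (w i) (w j)).smulRight (exteriorPower.ιMulti A 2 ![e i, e j]) =
        (2 : A) • LinearMap.id := by
      apply exteriorPower.linearMap_ext
      ext1 m
      obtain ⟨u, v, rfl⟩ : ∃ u v, m = ![u, v] := ⟨m 0, m 1, by ext i; fin_cases i <;> rfl⟩
      have hswap : exteriorPower.ιMulti A 2 ![v, u] = - exteriorPower.ιMulti A 2 ![u, v] := by
        have := (exteriorPower.ιMulti A 2 (M := E)).map_swap ![u, v] (i := 0) (j := 1) (by simp)
        rw [← this]
        congr 1
        ext i; fin_cases i <;> rfl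
      have h1 := hsum u v
      have h2 := hsum v u
      simp only [LinearMap.compAlternatingMap_apply, LinearMap.sum_apply,
        LinearMap.smulRight_apply, hl, wedgePairing_ιMulti, hw'', sub_smul,
        Finset.sum_sub_distrib, LinearMap.smul_apply, LinearMap.id_apply, h1, h2, hswap]
      rw [two_smul, sub_neg_eq_add]
    intro ω
    simpa [hl] using LinearMap.congr_fun hext ω
  have huniq : ∀ ω ω' : ⋀[A]^2 E,
      (∀ x y, wedgePairing B ω x y = wedgePairing B ω' x y) → ω = ω' := by
    intro ω ω' h
    have h2 := key ω
    simp only [h, key ω'] at h2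
    simpa [smul_smul] using congrArg (fun z => ⅟(2 : A) • z) h2.symm
  have hex : ∀ x y, wedgePairing B
      (⅟(2 : A) • ∑ i, exteriorPower.ιMulti A 2 ![w i, T (e i)]) x y = B (T x) y := by
    intro x y
    have hTx : ∀ x y, ∑ i, g x i * B (T (e i)) y = B (T x) y := by
      intro x y
      conv_rhs => rw [← hexp x]
      simp
    rw [← hl, map_smul, map_sum]
    simp only [hl, wedgePairing_ιMulti, hw']
    rw [Finset.sum_sub_distrib, hTx]
    have : ∑ i, B (T (e i)) x * g y i = B (T y) x := by
      rw [← hTx]; exact Finset.sum_congr rfl fun i _ => mul_comm _ _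
    rw [this, hT y x, sub_neg_eq_add, ← two_mul, smul_eq_mul, invOf_mul_cancel_left']
  exact ⟨_, hex, fun ω hω => huniq _ _ fun x y => (hω x y).trans (hex x y).symm⟩

end ExteriorSquare

section Connection

variable (R A E : Type*) [CommRing R] [CommRing A] [Algebra R A] [AddCommGroup E] [Module A E]

/-- A connection (covariant derivative) on the `A`-module `E`, in the directions `Der_R(A)`. -/
structure Connection where
  /-- the covariant derivative `∇_D x` -/
  cov : Derivation R A A → E → E
  add_left : ∀ D D' x, cov (D + D') x = cov D x + cov D' x
  smul_left : ∀ (a : A) D x, cov (a • D) x = a • cov D x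
  add_right : ∀ D x y, cov D (x + y) = cov D x + cov D y
  leibniz : ∀ D (a : A) x, cov D (a • x) = a • cov D x + D a • x

variable {R A E}

/-- `∇` is compatible with the form `B`. -/
def Connection.IsMetric (nabla : Connection R A E) (B : LinearMap.BilinForm A E) : Prop :=
  ∀ (D : Derivation R A A) (x y : E), D (B x y) = B (nabla.cov D x) y + B x (nabla.cov D y)

/-- The form `B` is strongly nondegenerate: `x ↦ ⟨x, ·⟩` is an isomorphism onto the dual. -/
def StronglyNondegenerate (B : LinearMap.BilinForm A E) : Prop :=
  Function.Bijective (B : E → Module.Dual A E)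

/-- The form `B` is full: the induced map `E ⊗ E → A` is surjective. -/
def IsFull (B : LinearMap.BilinForm A E) : Prop :=
  Function.Surjective (TensorProduct.lift B)

theorem Connection.sub_right (nabla : Connection R A E) (D : Derivation R A A) (x y : E) :
    nabla.cov D (x - y) = nabla.cov D x - nabla.cov D y :=
  map_sub (AddMonoidHom.mk' (nabla.cov D) (nabla.add_right D)) x y

/-- The curvature `R(D, D') = ∇_D ∇_D' - ∇_D' ∇_D - ∇_[D, D']` on `E`. -/
def Connection.curvature (nabla : Connection R A E) (D D' : Derivation R A A) : E →ₗ[A] E where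
  toFun x := nabla.cov D (nabla.cov D' x) - nabla.cov D' (nabla.cov D x) - nabla.cov ⁅D, D'⁆ x
  map_add' x y := by simp only [nabla.add_right]; abel
  map_smul' a x := by
    simp only [nabla.leibniz, nabla.add_right, Derivation.commutator_apply, RingHom.id_apply,
      smul_sub, sub_smul]
    abel

theorem Connection.curvature_skew (nabla : Connection R A E) (B : LinearMap.BilinForm A E)
    (hB : B.IsSymm) (hm : nabla.IsMetric B) (D D' : Derivation R A A) (x y : E) :
    B (nabla.curvature D D' x) y = - B (nabla.curvature D D' y) x := by
  have h1 := hm ⁅D, D'⁆ x y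
  rw [Derivation.commutator_apply, hm D' x y, hm D x y, map_add, map_add, hm, hm, hm, hm] at h1
  have hs : B (nabla.curvature D D' y) x = B x (nabla.curvature D D' y) := hB.eq _ _
  rw [hs]
  simp only [Connection.curvature, LinearMap.coe_mk, AddHom.coe_mk, map_sub, LinearMap.sub_apply]
  linear_combination h1

theorem existsUnique_curvatureTwoVector [Algebra ℚ R] [Module.Finite A E] [Module.Projective A E]
    (B : LinearMap.BilinForm A E) (hB : B.IsSymm) (hnd : StronglyNondegenerate B)
    (nabla : Connection R A E) (hm : nabla.IsMetric B) (D D' : Derivation R A A) :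
    ∃! ω : ⋀[A]^2 E, ∀ x y, wedgePairing B ω x y = B (nabla.curvature D D' x) y := by
  refine existsUnique_twoVector ?_ B hB hnd _ (nabla.curvature_skew B hB hm D D')
  simpa only [map_ofNat] using
    ((IsUnit.mk0 (2 : ℚ) two_ne_zero).map (algebraMap ℚ R)).map (algebraMap R A)

/-- The curvature 2-vector `r(D, D') ∈ Λ²E` of a metric connection: the unique element with
`⟨r(D, D'), x ∧ y⟩ = ⟨R(D, D') x, y⟩` for all `x, y`. -/
def curvatureTwoVector [Algebra ℚ R] [Module.Finite A E] [Module.Projective A E]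
    (B : LinearMap.BilinForm A E) (hB : B.IsSymm) (hnd : StronglyNondegenerate B)
    (nabla : Connection R A E) (hm : nabla.IsMetric B) (D D' : Derivation R A A) : ⋀[A]^2 E :=
  (existsUnique_curvatureTwoVector B hB hnd nabla hm D D').choose

theorem curvatureTwoVector_spec [Algebra ℚ R] [Module.Finite A E] [Module.Projective A E]
    (B : LinearMap.BilinForm A E) (hB : B.IsSymm) (hnd : StronglyNondegenerate B)
    (nabla : Connection R A E) (hm : nabla.IsMetric B) (D D' : Derivation R A A) (x y : E) :
    wedgePairing B (curvatureTwoVector B hB hnd nabla hm D D') x y =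
      B (nabla.curvature D D' x) y :=
  (existsUnique_curvatureTwoVector B hB hnd nabla hm D D').choose_spec.1 x y

end Connection

section Algebra

variable (R A E : Type*) [CommRing R] [CommRing A] [Algebra R A] [AddCommGroup E] [Module A E]

/-- The Rothstein algebra `Sym_A Der(A) ⊗_A Λ_A E`, with the product
`(P ⊗ ξ)(Q ⊗ η) = (P ∨ Q) ⊗ (ξ ∧ η)` of the tensor product of `A`-algebras. -/
abbrev RothsteinAlgebra : Type _ :=
  SymmetricAlgebra A (Derivation R A A) ⊗[A] ExteriorAlgebra A E

/-- The symmetric power `Sym^p_A Der(A)` inside the symmetric algebra. -/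
def symPower (p : ℕ) : Submodule A (SymmetricAlgebra A (Derivation R A A)) :=
  LinearMap.range (SymmetricAlgebra.ι A (Derivation R A A)) ^ p

/-- The homogeneous component of degree `r` of the Rothstein algebra: the sum over `2p + k = r`
of the summands `Sym^p_A Der(A) ⊗_A Λ^k_A E`. -/
def rothsteinGrading (r : ℕ) : Submodule A (RothsteinAlgebra R A E) :=
  ⨆ (p : ℕ) (k : ℕ) (_ : 2 * p + k = r),
    Submodule.map₂ (TensorProduct.mk A _ _) (symPower R A p) (⋀[A]^k E)

variable {A E}

/-- The inclusion of `A` as the degree `0` part. -/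
def ofScalar (a : A) : RothsteinAlgebra R A E :=
  algebraMap A (RothsteinAlgebra R A E) a

/-- The inclusion of `Λ_A E`; it carries `Λ^k_A E` to degree `k`. -/
def ofExterior (ξ : ExteriorAlgebra A E) : RothsteinAlgebra R A E :=
  1 ⊗ₜ[A] ξ

/-- The inclusion of `E` as the degree `1` part. -/
def ofModule (x : E) : RothsteinAlgebra R A E :=
  ofExterior R (ExteriorAlgebra.ι A x)

variable (E) {R}

/-- The inclusion of `Der(A)` in degree `2`. -/
def ofDer (D : Derivation R A A) : RothsteinAlgebra R A E :=
  SymmetricAlgebra.ι A (Derivation R A A) D ⊗ₜ[A] 1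

end Algebra

/-- A graded Poisson bracket of degree `-2` on an `R`-algebra `P` whose homogeneous components
are `G 0, G 1, …`: an `R`-bilinear bracket mapping `G r × G s` to `G (r + s - 2)` (and to `0` if
`r + s < 2`), which is graded antisymmetric and satisfies the graded Leibniz rule and the graded
Jacobi identity. Elements not required to be homogeneous occur where no sign depends on their
degree. -/
structure IsGradedPoissonBracket {R A P : Type*} [CommRing R] [CommRing A] [Ring P] [Module R P]
    [Module A P] (G : ℕ → Submodule A P) (br : P →ₗ[R] P →ₗ[R] P) : Prop where
  degree : ∀ r s t : ℕ, r + s = t + 2 → ∀ φ ∈ G r, ∀ ψ ∈ G s, br φ ψ ∈ G t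
  degree_neg : ∀ r s : ℕ, r + s < 2 → ∀ φ ∈ G r, ∀ ψ ∈ G s, br φ ψ = 0
  antisymm : ∀ r s : ℕ, ∀ φ ∈ G r, ∀ ψ ∈ G s, br φ ψ = -((-1) ^ (r * s) * br ψ φ)
  leibniz : ∀ r s : ℕ, ∀ φ ∈ G r, ∀ ψ ∈ G s, ∀ χ : P,
    br φ (ψ * χ) = br φ ψ * χ + (-1) ^ (r * s) * (ψ * br φ χ)
  jacobi : ∀ r s : ℕ, ∀ φ ∈ G r, ∀ ψ ∈ G s, ∀ χ : P,
    br φ (br ψ χ) = br (br φ ψ) χ + (-1) ^ (r * s) * br ψ (br φ χ)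

end Rothstein

end

open scoped TensorProduct

noncomputable section

namespace Rothstein

universe u

/-! By the Leibniz rule and antisymmetry a bracket is determined by its values on the generators `a
c`, `x v`, `d D`; this gives uniqueness (`br_unique`). For existence, the Rothstein algebra is
treated as the graded commutative ring with these generators and only the obvious relations, as
recorded in `GradedPresentation`. A graded derivation δ is the same thing as a ring homomorphism φ ↦
[[±φ, δφ], [0, φ]] into 2×2 matrices, so the universal property produces a derivation from any
values on generators that respect the relations (`exists_isDer`).

The bracket is built in two rounds. The prescribed values give the derivations `Xa`, `Xx`, `Xd`,
which are to be {c, ·}, {v, ·}, {D, ·}. For arbitrary φ, antisymmetry then forces the values of {φ,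
·} on generators, namely ±X applied to φ; the relations hold because X itself obeys a Leibniz rule
in its index (`Xa_mul`, `Xx_smul`, `Xd_smul`). Antisymmetry of the result follows by induction from
its validity on generators.

The Jacobi identity is derivation-like in the last slot (`Jac.mul_right`) and invariant under
permuting the slots, so three generators suffice (`jac`). There it amounts to the definition of the
commutator, the metric property of ∇, the definition of the curvature and, for three derivations,
the second Bianchi identity (`jac_d_d_d`).

All signs depend only on degrees mod 2, so most of the argument uses the parity involution `sigma`;
the ℕ-grading enters mainly through induction on homogeneous elements, and its directness plays no
role. -/

/-- The ring `P` is generated over `A` by commuting degree two elements `d D`, one for each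
derivation `D` of `A`, and anticommuting degree one elements `x v`, one for each `v` in `E`, and
it is universal for this property. -/
structure GradedPresentation (R A E : Type*) (P : Type u) [CommRing R] [CommRing A] [Algebra R A]
    [AddCommGroup E] [Module A E] [Ring P] where
  a : A →+* P
  x : E →+ P
  d : Derivation R A A →+ P
  j : ⋀[A]^2 E →+ P
  G : ℕ → AddSubgroup P
  half : A
  half_add : half + half = 1
  a_injective : Function.Injective a
  x_smul : ∀ c v, x (c • v) = a c * x v
  d_smul : ∀ (c : A) D, d (c • D) = a c * d D
  j_smul : ∀ (c : A) ω, j (c • ω) = a c * j ω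
  j_wedge : ∀ v w, j (exteriorPower.ιMulti A 2 ![v, w]) = x v * x w
  a_central : ∀ c φ, a c * φ = φ * a c
  d_central : ∀ D φ, d D * φ = φ * d D
  x_sq : ∀ v, x v * x v = 0
  a_mem : ∀ c, a c ∈ G 0
  x_mem : ∀ v, x v ∈ G 1
  d_mem : ∀ D, d D ∈ G 2
  mul_mem : ∀ m n φ ψ, φ ∈ G m → ψ ∈ G n → φ * ψ ∈ G (m + n)
  hom_induction : ∀ C : ℕ → P → Prop, (∀ n, C n 0) →
    (∀ n φ ψ, C n φ → C n ψ → C n (φ + ψ)) →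
    (∀ c, C 0 (a c)) → (∀ v, C 1 (x v)) → (∀ D, C 2 (d D)) →
    (∀ m n φ ψ, φ ∈ G m → ψ ∈ G n → C m φ → C n ψ → C (m + n) (φ * ψ)) →
    ∀ n φ, φ ∈ G n → C n φ
  sum_induction : ∀ C : P → Prop, (∀ φ ψ, C φ → C ψ → C (φ + ψ)) →
    (∀ n φ, φ ∈ G n → C φ) → ∀ φ, C φ
  -- `T` is any ring, with `fa` not assumed central: the matrix ring over `P` is a target in which
  -- the image of `A` is twisted by a derivation.
  exists_lift : ∀ (T : Type u) [Ring T] (fa : A →+* T) (fx : E →+ T)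
    (fd : Derivation R A A →+ T), (∀ c v, fx (c • v) = fa c * fx v) →
    (∀ (c : A) D, fd (c • D) = fa c * fd D) → (∀ c v, Commute (fa c) (fx v)) →
    (∀ c D, Commute (fa c) (fd D)) → (∀ D D', Commute (fd D) (fd D')) →
    (∀ D v, Commute (fd D) (fx v)) → (∀ v, fx v * fx v = 0) →
    ∃ F : P →+* T, (∀ c, F (a c) = fa c) ∧ (∀ v, F (x v) = fx v) ∧ ∀ D, F (d D) = fd D

namespace GradedPresentation

variable {R A E : Type*} {P : Type u} [CommRing R] [CommRing A] [Algebra R A]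
    [AddCommGroup E] [Module A E] [Ring P] (S : GradedPresentation R A E P)

/-! ### Parity and graded commutativity. -/

section Parity

theorem induction {C : P → Prop} (add : ∀ φ ψ, C φ → C ψ → C (φ + ψ))
    (a : ∀ c, C (S.a c)) (x : ∀ v, C (S.x v)) (d : ∀ D, C (S.d D))
    (mul : ∀ φ ψ, C φ → C ψ → C (φ * ψ)) (φ : P) : C φ := by
  refine S.sum_induction C add (fun n φ hφ => ?_) φ
  refine S.hom_induction (fun _ => C) (fun _ => ?_) (fun _ => add) a x d
    (fun _ _ φ ψ _ _ => mul φ ψ) n φ hφ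
  simpa using a 0

theorem x_anticomm (v w : E) : S.x v * S.x w = -(S.x w * S.x v) := by
  have h := S.x_sq (v + w)
  rw [map_add, add_mul, mul_add, mul_add, S.x_sq, S.x_sq, zero_add, add_zero] at h
  exact eq_neg_of_add_eq_zero_left h

theorem exists_sigma : ∃ F : P →+* P, (∀ c, F (S.a c) = S.a c) ∧ (∀ v, F (S.x v) = -S.x v) ∧
    ∀ D, F (S.d D) = S.d D := by
  refine S.exists_lift P S.a (-S.x) S.d (fun c v => ?_) S.d_smul (fun c v => S.a_central _ _)
    (fun c D => S.a_central _ _) (fun D D' => S.d_central _ _) (fun D v => S.d_central _ _)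
    (fun v => ?_)
  · simp [S.x_smul]
  · simp [S.x_sq]

/-- The parity involution. -/
def sigma : P →+* P := S.exists_sigma.choose

@[simp] theorem sigma_a (c : A) : S.sigma (S.a c) = S.a c := S.exists_sigma.choose_spec.1 c
@[simp] theorem sigma_x (v : E) : S.sigma (S.x v) = -S.x v := S.exists_sigma.choose_spec.2.1 v
@[simp] theorem sigma_d (D : Derivation R A A) : S.sigma (S.d D) = S.d D :=
  S.exists_sigma.choose_spec.2.2 D

@[simp] theorem sigma_sigma (φ : P) : S.sigma (S.sigma φ) = φ := by
  induction φ using S.induction with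
  | add φ ψ h h' => rw [map_add, map_add, h, h']
  | a c => simp
  | x v => simp
  | d D => simp
  | mul φ ψ h h' => rw [map_mul, map_mul, h, h']

/-- The power of the parity involution with exponent `0` or `1`. -/
def tw (b : Bool) : P →+* P := bif b then S.sigma else RingHom.id P

@[simp] theorem tw_false (φ : P) : S.tw false φ = φ := rfl
@[simp] theorem tw_true (φ : P) : S.tw true φ = S.sigma φ := rfl

/-- `φ` is even (`b = false`) or odd (`b = true`). -/
def Par (b : Bool) (φ : P) : Prop := S.sigma φ = bif b then -φ else φ

variable {S}

theorem Par.even {φ : P} (h : S.Par false φ) : S.sigma φ = φ := h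
theorem Par.odd {φ : P} (h : S.Par true φ) : S.sigma φ = -φ := h

theorem Par.add {b : Bool} {φ ψ : P} (h : S.Par b φ) (h' : S.Par b ψ) : S.Par b (φ + ψ) := by
  cases b <;> simp_all [Par, add_comm]

theorem Par.neg {b : Bool} {φ : P} (h : S.Par b φ) : S.Par b (-φ) := by
  cases b <;> simp_all [Par]

theorem Par.sub {b : Bool} {φ ψ : P} (h : S.Par b φ) (h' : S.Par b ψ) : S.Par b (φ - ψ) := by
  rw [sub_eq_add_neg]; exact h.add h'.neg

theorem Par.mul {b c : Bool} {φ ψ : P} (h : S.Par b φ) (h' : S.Par c ψ) :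
    S.Par (b ^^ c) (φ * ψ) := by
  cases b <;> cases c <;> simp_all [Par]

theorem Par.sigma {b : Bool} {φ : P} (h : S.Par b φ) : S.Par b (S.sigma φ) := by
  cases b <;> simp_all [Par]

theorem Par.tw {b : Bool} {φ : P} (c : Bool) (h : S.Par b φ) : S.Par b (S.tw c φ) := by
  cases c
  exacts [h, h.sigma]

variable (S)

theorem par_zero (b : Bool) : S.Par b 0 := by cases b <;> simp [Par]
theorem par_a (c : A) : S.Par false (S.a c) := S.sigma_a c
theorem par_x (v : E) : S.Par true (S.x v) := S.sigma_x v
theorem par_d (D : Derivation R A A) : S.Par false (S.d D) := S.sigma_d D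

/-- The bridge from degrees to parities, through which the signs (-1)^(mn) become twists by `sigma`.
-/
theorem par_of_mem {n : ℕ} {φ : P} (h : φ ∈ S.G n) : S.Par n.bodd φ := by
  refine S.hom_induction (fun n φ => S.Par n.bodd φ) (fun n => S.par_zero _)
    (fun n φ ψ => Par.add) S.par_a S.par_x S.par_d (fun m n φ ψ _ _ h h' => ?_) n φ h
  rw [Nat.bodd_add]
  exact h.mul h'

theorem half_mul_add (φ : P) : S.a S.half * (φ + φ) = φ := by
  rw [mul_add, ← add_mul, ← map_add, S.half_add, map_one, one_mul]

/-- The even and the odd part of `φ`. -/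
def part (b : Bool) : P →+ P :=
  (AddMonoidHom.mulLeft (S.a S.half)).comp
    (AddMonoidHom.id P + bif b then -S.sigma.toAddMonoidHom else S.sigma.toAddMonoidHom)

theorem part_false (φ : P) : S.part false φ = S.a S.half * (φ + S.sigma φ) := rfl
theorem part_true (φ : P) : S.part true φ = S.a S.half * (φ + -S.sigma φ) := rfl

theorem par_part (b : Bool) (φ : P) : S.Par b (S.part b φ) := by
  cases b
  · simp [Par, part_false, add_comm]
  · simp only [Par, part_true, map_mul, map_add, map_neg, sigma_a, sigma_sigma, cond_true]
    noncomm_ring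

theorem part_add_part (φ : P) : S.part false φ + S.part true φ = φ := by
  rw [part_false, part_true, ← mul_add]
  convert S.half_mul_add φ using 2
  abel

theorem part_not_of_par {b : Bool} {φ : P} (h : S.Par b φ) : S.part (!b) φ = 0 := by
  cases b
  · simp [part_true, h.even]
  · simp [part_false, h.odd]

theorem par_induction {C : P → Prop} (add : ∀ φ ψ, C φ → C ψ → C (φ + ψ))
    (par : ∀ b φ, S.Par b φ → C φ) (φ : P) : C φ := by
  rw [← S.part_add_part φ]
  exact add _ _ (par _ _ (S.par_part _ _)) (par _ _ (S.par_part _ _))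

theorem x_mul (v : E) (φ : P) : S.x v * φ = S.sigma φ * S.x v := by
  induction φ using S.induction with
  | add φ ψ h h' => rw [mul_add, map_add, add_mul, h, h']
  | a c => rw [sigma_a, S.a_central]
  | x w => rw [sigma_x, S.x_anticomm, neg_mul]
  | d D => rw [sigma_d, S.d_central]
  | mul φ ψ h h' => rw [map_mul, ← mul_assoc, h, mul_assoc, h', mul_assoc]

variable {S} in
/-- Graded commutativity. -/
theorem Par.mul_comm {b : Bool} {φ : P} (h : S.Par b φ) (ψ : P) : φ * ψ = S.tw b ψ * φ := by
  induction ψ using S.induction with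
  | add ψ χ h h' => rw [mul_add, map_add, add_mul, h, h']
  | a c => cases b <;> simp [S.a_central]
  | x v =>
    have := S.x_mul v φ
    cases b
    · rw [tw_false, this, h.even]
    · rw [tw_true, sigma_x, neg_mul, this, h.odd, neg_mul, neg_neg]
  | d D => cases b <;> simp [S.d_central]
  | mul ψ χ h h' => rw [map_mul, ← mul_assoc, h, mul_assoc, h', mul_assoc]

end Parity

/-! ### Graded derivations from their values on generators. -/

section Der

/-- Even (`b = false`) or odd (`b = true`) derivations of the ring `P`, except that they need not
respect the parity. -/
def IsDer (b : Bool) (δ : P →+ P) : Prop :=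
  ∀ φ ψ, δ (φ * ψ) = δ φ * ψ + S.tw b φ * δ ψ

variable {S}

theorem IsDer.add {b : Bool} {δ ε : P →+ P} (h : S.IsDer b δ) (h' : S.IsDer b ε) :
    S.IsDer b (δ + ε) := by
  intro φ ψ
  simp only [AddMonoidHom.add_apply, h φ ψ, h' φ ψ]
  noncomm_ring

theorem IsDer.neg {b : Bool} {δ : P →+ P} (h : S.IsDer b δ) : S.IsDer b (-δ) := by
  intro φ ψ
  simp only [AddMonoidHom.neg_apply, h φ ψ]
  noncomm_ring

theorem isDer_zero (b : Bool) : S.IsDer b 0 := by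
  intro φ ψ
  simp

theorem tw_comm (b c : Bool) (φ : P) : S.tw b (S.tw c φ) = S.tw c (S.tw b φ) := by
  cases b <;> cases c <;> rfl

theorem tw_tw (b c : Bool) (φ : P) : S.tw b (S.tw c φ) = S.tw (b ^^ c) φ := by
  cases b <;> cases c <;> simp

theorem IsDer.mul_left {b c : Bool} {δ : P →+ P} (h : S.IsDer b δ) {φ : P} (hφ : S.Par c φ) :
    S.IsDer (b ^^ c) ((AddMonoidHom.mulLeft φ).comp δ) := by
  intro ψ χ
  simp only [AddMonoidHom.comp_apply, AddMonoidHom.coe_mulLeft, h ψ χ]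
  rw [mul_add, ← mul_assoc φ (S.tw b ψ), hφ.mul_comm (S.tw b ψ), tw_tw, Bool.xor_comm]
  noncomm_ring

theorem IsDer.ext {b : Bool} {δ ε : P →+ P} (h : S.IsDer b δ) (h' : S.IsDer b ε)
    (a : ∀ c, δ (S.a c) = ε (S.a c)) (x : ∀ v, δ (S.x v) = ε (S.x v))
    (d : ∀ D, δ (S.d D) = ε (S.d D)) : δ = ε := by
  ext φ
  induction φ using S.induction with
  | add φ ψ h h' => rw [map_add, map_add, h, h']
  | a c => exact a c
  | x v => exact x v
  | d D => exact d D
  | mul φ ψ hφ hψ => rw [h, h', hφ, hψ]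

/-- The twist `b` in the Leibniz rule and the parity shift `p` of the map are independent
parameters; the shift can be read off on generators. -/
theorem IsDer.map_sigma {b p : Bool} {δ : P →+ P} (h : S.IsDer b δ)
    (a : ∀ c, S.Par p (δ (S.a c))) (x : ∀ v, S.Par (!p) (δ (S.x v)))
    (d : ∀ D, S.Par p (δ (S.d D))) (φ : P) :
    S.sigma (δ φ) = bif p then -δ (S.sigma φ) else δ (S.sigma φ) := by
  induction φ using S.induction with
  | add φ ψ h h' => cases p <;> simp_all [add_comm]
  | a c => rw [sigma_a]; exact a c
  | x v =>
    have := x v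
    cases p <;> simp_all [Par]
  | d D => rw [sigma_d]; exact d D
  | mul φ ψ hφ hψ =>
    rw [h, map_add, map_mul, map_mul, hφ, hψ, map_mul, h]
    cases p <;> cases b <;> simp [add_comm]

theorem IsDer.par {b p c : Bool} {δ : P →+ P} (h : S.IsDer b δ)
    (a : ∀ c, S.Par p (δ (S.a c))) (x : ∀ v, S.Par (!p) (δ (S.x v)))
    (d : ∀ D, S.Par p (δ (S.d D))) {φ : P} (hφ : S.Par c φ) : S.Par (p ^^ c) (δ φ) := by
  have := h.map_sigma a x d φ
  rw [Par, this, hφ]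
  cases p <;> cases c <;> simp

/-- A pair of a twist and a twisted derivation as a matrix valued map. -/
def derMatrix (S : GradedPresentation R A E P) (b : Bool) {M : Type*} [AddCommGroup M]
    (f δ : M →+ P) : M →+ Matrix (Fin 2) (Fin 2) P where
  toFun m := !![S.tw b (f m), δ m; 0, f m]
  map_zero' := by ext i j; fin_cases i <;> fin_cases j <;> simp
  map_add' m n := by ext i j; fin_cases i <;> fin_cases j <;> simp

theorem derMatrix_apply (b : Bool) {M : Type*} [AddCommGroup M]
    (f δ : M →+ P) (m : M) : S.derMatrix b f δ m = !![S.tw b (f m), δ m; 0, f m] := rfl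

/-- The matrices inherit graded commutation: in the off-diagonal entry the two Leibniz terms cancel
against each other because `δ` and `ε` shift parity by `b`. -/
theorem derMatrix_mul {b p q : Bool} {M N : Type*} [AddCommGroup M] [AddCommGroup N]
    {f δ : M →+ P} {g ε : N →+ P} {m : M} {n : N}
    (hf : S.Par p (f m)) (hg : S.Par q (g n)) (hδ : S.Par (b ^^ p) (δ m))
    (hε : S.Par (b ^^ q) (ε n)) (s : Bool) (hs : s = (p && q)) :
    S.derMatrix b f δ m * S.derMatrix b g ε n =
      bif s then -(S.derMatrix b g ε n * S.derMatrix b f δ m)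
        else S.derMatrix b g ε n * S.derMatrix b f δ m := by
  subst hs
  simp only [derMatrix_apply, Matrix.mul_fin_two]
  have h1 := hf.mul_comm (g n)
  have h2 := hδ.mul_comm (g n)
  have h3 := hf.mul_comm (ε n)
  have h4 := hf.mul_comm (S.tw b (g n))
  unfold Par at *
  ext i k
  cases b <;> cases p <;> cases q <;> fin_cases i <;> fin_cases k <;> simp_all [add_comm]

/-- Multiplicativity of φ ↦ [[tw φ, δφ], [0, φ]] is exactly the twisted Leibniz rule for δ. The
commutation relations hold by parity alone, so only `ha`, `hx`, `hd` remain as conditions. -/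
theorem exists_isDer (S : GradedPresentation R A E P) (b : Bool) (da : A →+ P) (dx : E →+ P)
    (dd : Derivation R A A →+ P)
    (pa : ∀ c, S.Par b (da c)) (px : ∀ v, S.Par (!b) (dx v)) (pd : ∀ D, S.Par b (dd D))
    (ha : ∀ c c', da (c * c') = da c * S.a c' + S.a c * da c')
    (hx : ∀ c v, dx (c • v) = da c * S.x v + S.a c * dx v)
    (hd : ∀ (c : A) D, dd (c • D) = da c * S.d D + S.a c * dd D) :
    ∃ δ : P →+ P, S.IsDer b δ ∧ (∀ c, δ (S.a c) = da c) ∧ (∀ v, δ (S.x v) = dx v) ∧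
      ∀ D, δ (S.d D) = dd D := by
  have px' : ∀ v, S.Par (b ^^ true) (dx v) := fun v => by simpa using px v
  have pa' : ∀ v, S.Par (b ^^ false) (da v) := fun v => by simpa using pa v
  have pd' : ∀ v, S.Par (b ^^ false) (dd v) := fun v => by simpa using pd v
  have twa : ∀ c, S.tw b (S.a c) = S.a c := fun c => by cases b <;> simp
  have da1 : da 1 = 0 := by simpa using ha 1 1
  let fa : A →+* Matrix (Fin 2) (Fin 2) P :=
    { S.derMatrix b S.a.toAddMonoidHom da with
      map_one' := by
        ext i k; fin_cases i <;> fin_cases k <;> simp [derMatrix_apply, da1]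
      map_mul' := fun c c' => by
        ext i k
        fin_cases i <;> fin_cases k <;> simp [derMatrix_apply, twa, ha, add_comm] }
  have fa_eq : ∀ c, fa c = S.derMatrix b S.a.toAddMonoidHom da c := fun _ => rfl
  obtain ⟨F, Fa, Fx, Fd⟩ := S.exists_lift (Matrix (Fin 2) (Fin 2) P) fa (S.derMatrix b S.x dx)
    (S.derMatrix b S.d dd)
    (fun c v => by
      ext i k
      fin_cases i <;> fin_cases k <;>
        simp [fa_eq, derMatrix_apply, twa, hx, S.x_smul, add_comm])
    (fun c v => by
      ext i k
      fin_cases i <;> fin_cases k <;>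
        simp [fa_eq, derMatrix_apply, twa, hd, S.d_smul, add_comm])
    (fun c v => derMatrix_mul (S.par_a c) (S.par_x v) (pa' c) (px' v) false rfl)
    (fun c D => derMatrix_mul (S.par_a c) (S.par_d D) (pa' c) (pd' D) false rfl)
    (fun D D' => derMatrix_mul (S.par_d D) (S.par_d D') (pd' D) (pd' D') false rfl)
    (fun D v => derMatrix_mul (S.par_d D) (S.par_x v) (pd' D) (px' v) false rfl)
    -- The off-diagonal entry is `tw b (x v) * dx v + dx v * x v`; it vanishes since `dx v` has
    -- parity opposite to `b`.
    (fun v => by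
      have h1 := S.x_sq v
      have h2 := (S.par_x v).mul_comm (dx v)
      have h3 := px v
      unfold Par at h3
      ext i k
      cases b <;> fin_cases i <;> fin_cases k <;> simp_all [derMatrix_apply])
  -- With these three entries known, the remaining one satisfies the Leibniz rule.
  have hF : ∀ φ, F φ 0 0 = S.tw b φ ∧ F φ 1 0 = 0 ∧ F φ 1 1 = φ := by
    intro φ
    induction φ using S.induction with
    | add φ ψ h h' => simp [h, h']
    | a c => simp [Fa, fa_eq, derMatrix_apply]
    | x v => simp [Fx, derMatrix_apply]
    | d D => simp [Fd, derMatrix_apply]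
    | mul φ ψ h h' => simp [Matrix.mul_apply, h, h']
  refine ⟨AddMonoidHom.mk' (fun φ => F φ 0 1) (fun φ ψ => by simp), fun φ ψ => ?_, fun c => ?_,
    fun v => ?_, fun D => ?_⟩
  · simp [Matrix.mul_apply, hF, add_comm]
  · simp [Fa, fa_eq, derMatrix_apply]
  · simp [Fx, derMatrix_apply]
  · simp [Fd, derMatrix_apply]

/-- The homogeneous components, indexed by integers. -/
def GZ (S : GradedPresentation R A E P) (n : ℤ) : AddSubgroup P := ⨆ (k : ℕ) (_ : (k : ℤ) = n), S.G k

theorem GZ_natCast (n : ℕ) : S.GZ n = S.G n := by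
  refine le_antisymm (iSup₂_le fun k hk => ?_) (le_iSup₂_of_le n rfl le_rfl)
  rw [Nat.cast_injective hk]

/-- Integer indices let a single membership statement contain both the degree of the bracket and its
vanishing when m + n < 2. -/
theorem GZ_neg {n : ℤ} (hn : n < 0) : S.GZ n = ⊥ := by
  refine le_antisymm (iSup₂_le fun k hk => ?_) bot_le
  omega

theorem GZ_mul_mem {m n : ℤ} {φ ψ : P} (hφ : φ ∈ S.GZ m) (hψ : ψ ∈ S.GZ n) :
    φ * ψ ∈ S.GZ (m + n) := by
  obtain hm | hm := lt_or_ge m 0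
  · rw [GZ_neg hm, AddSubgroup.mem_bot] at hφ
    rw [hφ, zero_mul]; exact zero_mem _
  obtain hn | hn := lt_or_ge n 0
  · rw [GZ_neg hn, AddSubgroup.mem_bot] at hψ
    rw [hψ, mul_zero]; exact zero_mem _
  lift m to ℕ using hm
  lift n to ℕ using hn
  rw [← Nat.cast_add, GZ_natCast]
  rw [GZ_natCast] at hφ hψ
  exact S.mul_mem m n φ ψ hφ hψ

theorem sigma_mem {n : ℤ} {φ : P} (hφ : φ ∈ S.GZ n) : S.sigma φ ∈ S.GZ n := by
  obtain hn | hn := lt_or_ge n 0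
  · rw [GZ_neg hn, AddSubgroup.mem_bot] at hφ
    rw [hφ, map_zero]; exact zero_mem _
  lift n to ℕ using hn
  rw [GZ_natCast] at hφ ⊢
  rw [S.par_of_mem hφ]
  cases n.bodd
  exacts [hφ, neg_mem hφ]

theorem IsDer.map_mem {b : Bool} {δ : P →+ P} (h : S.IsDer b δ) {k : ℤ}
    (a : ∀ c, δ (S.a c) ∈ S.GZ k) (x : ∀ v, δ (S.x v) ∈ S.GZ (1 + k))
    (d : ∀ D, δ (S.d D) ∈ S.GZ (2 + k)) {n : ℤ} {φ : P} (hφ : φ ∈ S.GZ n) :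
    δ φ ∈ S.GZ (n + k) := by
  obtain hn | hn := lt_or_ge n 0
  · rw [GZ_neg hn, AddSubgroup.mem_bot] at hφ
    rw [hφ, map_zero]; exact zero_mem _
  lift n to ℕ using hn
  rw [GZ_natCast] at hφ
  refine S.hom_induction (fun n φ => δ φ ∈ S.GZ (n + k)) (fun n => ?_) (fun n φ ψ hφ hψ => ?_)
    (by simpa using a) (by simpa using x) (by simpa using d)
    (fun m n φ ψ hφ hψ h1 h2 => ?_) n φ hφ
  · simp [zero_mem]
  · rw [map_add]; exact add_mem hφ hψ
  · rw [h]
    rw [← GZ_natCast] at hφ hψ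
    refine add_mem ?_ ?_
    · convert GZ_mul_mem h1 hψ using 2
      push_cast; ring
    · have h3 : S.tw b φ ∈ S.GZ m := by
        cases b
        exacts [hφ, sigma_mem hφ]
      convert GZ_mul_mem h3 h2 using 2
      push_cast; ring

end Der

end GradedPresentation

/-! ### Hamiltonian derivations of the generators. -/

/-- A metric connection together with its curvature as a 2-vector valued form. -/
structure CurvedConnection (R A E : Type*) [CommRing R] [CommRing A] [Algebra R A]
    [AddCommGroup E] [Module A E] where
  B : LinearMap.BilinForm A E
  symm : ∀ v w, B v w = B w v
  nondegenerate : ∀ v, (∀ w, B v w = 0) → v = 0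
  nabla : Connection R A E
  metric : nabla.IsMetric B
  r : Derivation R A A →+ Derivation R A A →+ ⋀[A]^2 E
  r_smul : ∀ (c : A) D D', r D (c • D') = c • r D D'
  r_neg : ∀ D D', r D D' = -r D' D
  r_spec : ∀ D D' v w, wedgePairing B (r D D') v w = B (nabla.curvature D D' v) w
  wedge_ext : ∀ ω : ⋀[A]^2 E, (∀ v w, wedgePairing B ω v w = 0) → ω = 0

namespace GradedPresentation

variable {R A E : Type*} {P : Type u} [CommRing R] [CommRing A] [Algebra R A]
    [AddCommGroup E] [Module A E] [Ring P] (S : GradedPresentation R A E P)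
    (T : CurvedConnection R A E)

theorem wedge_induction {C : ⋀[A]^2 E → Prop} (add : ∀ ω ω', C ω → C ω' → C (ω + ω'))
    (smul : ∀ (c : A) v w, C (c • exteriorPower.ιMulti A 2 ![v, w])) (ω : ⋀[A]^2 E) : C ω := by
  have h : ω ∈ Submodule.span A (Set.range (exteriorPower.ιMulti A 2 (M := E))) := by
    rw [exteriorPower.ιMulti_span]; trivial
  suffices ∀ c : A, C (c • ω) by simpa using this 1
  induction h using Submodule.span_induction with
  | mem ω h =>
    obtain ⟨m, rfl⟩ := h
    intro c
    obtain ⟨v, w, rfl⟩ : ∃ v w, m = ![v, w] := ⟨m 0, m 1, by ext i; fin_cases i <;> rfl⟩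
    exact smul c v w
  | zero => intro c; simpa using smul 0 0 0
  | add ω ω' _ _ h h' => intro c; rw [smul_add]; exact add _ _ (h c) (h' c)
  | smul c ω _ h => intro c'; rw [smul_smul]; exact h _

theorem j_mem (ω : ⋀[A]^2 E) : S.j ω ∈ S.G 2 := by
  induction ω using wedge_induction with
  | add ω ω' h h' => rw [map_add]; exact add_mem h h'
  | smul c v w =>
    rw [S.j_smul, S.j_wedge]
    exact S.mul_mem 0 2 _ _ (S.a_mem c) (S.mul_mem 1 1 _ _ (S.x_mem v) (S.x_mem w))

theorem par_j (ω : ⋀[A]^2 E) : S.Par false (S.j ω) := S.par_of_mem (S.j_mem ω)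

/-- This is to be {c, ·}; its value on `d D` is forced by {D, c} = -D(c) and antisymmetry. -/
theorem exists_scalarDer (c : A) : ∃ δ : P →+ P, S.IsDer false δ ∧ (∀ c', δ (S.a c') = 0) ∧
    (∀ v, δ (S.x v) = 0) ∧ ∀ D, δ (S.d D) = S.a (D c) := by
  refine exists_isDer S false 0 0
    (AddMonoidHom.mk' (fun D => S.a (D c)) fun D D' => by simp) (fun _ => S.par_zero _)
    (fun _ => S.par_zero _) (fun D => S.par_a _) (by simp) (by simp) (fun c' D => ?_)
  simp

theorem exists_moduleDer (v : E) : ∃ δ : P →+ P, S.IsDer true δ ∧ (∀ c', δ (S.a c') = 0) ∧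
    (∀ w, δ (S.x w) = S.a (T.B v w)) ∧ ∀ D, δ (S.d D) = S.x (T.nabla.cov D v) := by
  refine exists_isDer S true 0
    (AddMonoidHom.mk' (fun w => S.a (T.B v w)) fun D D' => by simp)
    (AddMonoidHom.mk' (fun D => S.x (T.nabla.cov D v)) fun D D' => by simp [T.nabla.add_left])
    (fun _ => S.par_zero _)
    (fun w => S.par_a _) (fun D => S.par_x _) (by simp) (fun c w => ?_) (fun c' D => ?_)
  · simp
  · simp [T.nabla.smul_left, S.x_smul]

/-- The relations are respected because `D`, ∇_D and ⁅D, ·⁆ are all derivations over `D`, while `r`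
is `A`-linear in its second argument. -/
theorem exists_derDer (D : Derivation R A A) : ∃ δ : P →+ P, S.IsDer false δ ∧
    (∀ c, δ (S.a c) = -S.a (D c)) ∧ (∀ v, δ (S.x v) = -S.x (T.nabla.cov D v)) ∧
    ∀ D', δ (S.d D') = -S.d ⁅D, D'⁆ - S.j (T.r D D') := by
  refine exists_isDer S false
    (AddMonoidHom.mk' (fun c => -S.a (D c)) fun _ _ => by simp [add_comm])
    (AddMonoidHom.mk' (fun w => -S.x (T.nabla.cov D w)) fun _ _ => by
      simp [T.nabla.add_right, add_comm])
    (AddMonoidHom.mk' (fun D' => -S.d ⁅D, D'⁆ - S.j (T.r D D')) fun D D' => by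
      simp only [map_add, lie_add]; abel)
    (fun _ => (S.par_a _).neg)
    (fun w => (S.par_x _).neg) (fun D => (S.par_d _).neg.sub (S.par_j _))
    (fun c c' => ?_) (fun c w => ?_) (fun c D' => ?_)
  · simp only [AddMonoidHom.mk'_apply, Derivation.leibniz, map_add, smul_eq_mul, map_mul]
    rw [S.a_central c' (S.a (D c))]
    noncomm_ring
  · simp only [AddMonoidHom.mk'_apply, T.nabla.leibniz, map_add, S.x_smul]
    noncomm_ring
  · have : ⁅D, c • D'⁆ = c • ⁅D, D'⁆ + D c • D' := by
      ext c'
      simp only [Derivation.commutator_apply, Derivation.smul_apply, Derivation.add_apply,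
        Derivation.leibniz, smul_eq_mul]
      ring
    simp only [AddMonoidHom.mk'_apply, this, map_add, S.d_smul, T.r_smul, S.j_smul]
    noncomm_ring

/-- The Hamiltonian derivation of a scalar. -/
def Xa (c : A) : P →+ P := (S.exists_scalarDer c).choose
/-- The Hamiltonian derivation of an element of the module. -/
def Xx (v : E) : P →+ P := (S.exists_moduleDer T v).choose
/-- The Hamiltonian derivation of a derivation. -/
def Xd (D : Derivation R A A) : P →+ P := (S.exists_derDer T D).choose

theorem isDer_Xa (c : A) : S.IsDer false (S.Xa c) := (S.exists_scalarDer c).choose_spec.1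
@[simp] theorem Xa_a (c c' : A) : S.Xa c (S.a c') = 0 :=
  (S.exists_scalarDer c).choose_spec.2.1 c'
@[simp] theorem Xa_x (c : A) (v : E) : S.Xa c (S.x v) = 0 :=
  (S.exists_scalarDer c).choose_spec.2.2.1 v
@[simp] theorem Xa_d (c : A) (D : Derivation R A A) : S.Xa c (S.d D) = S.a (D c) :=
  (S.exists_scalarDer c).choose_spec.2.2.2 D

theorem isDer_Xx (v : E) : S.IsDer true (S.Xx T v) := (S.exists_moduleDer T v).choose_spec.1
@[simp] theorem Xx_a (v : E) (c' : A) : S.Xx T v (S.a c') = 0 :=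
  (S.exists_moduleDer T v).choose_spec.2.1 c'
@[simp] theorem Xx_x (v w : E) : S.Xx T v (S.x w) = S.a (T.B v w) :=
  (S.exists_moduleDer T v).choose_spec.2.2.1 w
@[simp] theorem Xx_d (v : E) (D : Derivation R A A) :
    S.Xx T v (S.d D) = S.x (T.nabla.cov D v) :=
  (S.exists_moduleDer T v).choose_spec.2.2.2 D

theorem isDer_Xd (D : Derivation R A A) : S.IsDer false (S.Xd T D) :=
  (S.exists_derDer T D).choose_spec.1
@[simp] theorem Xd_a (D : Derivation R A A) (c : A) : S.Xd T D (S.a c) = -S.a (D c) :=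
  (S.exists_derDer T D).choose_spec.2.1 c
@[simp] theorem Xd_x (D : Derivation R A A) (v : E) :
    S.Xd T D (S.x v) = -S.x (T.nabla.cov D v) :=
  (S.exists_derDer T D).choose_spec.2.2.1 v
@[simp] theorem Xd_d (D D' : Derivation R A A) :
    S.Xd T D (S.d D') = -S.d ⁅D, D'⁆ - S.j (T.r D D') :=
  (S.exists_derDer T D).choose_spec.2.2.2 D'

theorem Xa_par (c : A) {b : Bool} {φ : P} (h : S.Par b φ) : S.Par b (S.Xa c φ) := by
  simpa using (S.isDer_Xa c).par (p := false) (fun c' => by simpa using S.par_zero _)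
    (fun v => by simpa using S.par_zero _) (fun D => by simpa using S.par_a _) h

theorem Xx_par (v : E) {b : Bool} {φ : P} (h : S.Par b φ) : S.Par (!b) (S.Xx T v φ) := by
  simpa using (S.isDer_Xx T v).par (p := true) (fun c' => by simpa using S.par_zero _)
    (fun v => by simpa using S.par_a _) (fun D => by simpa using S.par_x _) h

theorem Xd_par (D : Derivation R A A) {b : Bool} {φ : P} (h : S.Par b φ) :
    S.Par b (S.Xd T D φ) := by
  simpa using (S.isDer_Xd T D).par (p := false) (fun c' => by simpa using (S.par_a _).neg)
    (fun v => by simpa using (S.par_x _).neg)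
    (fun D => by simpa using (S.par_d _).neg.sub (S.par_j _)) h

theorem Xa_add (c c' : A) (φ : P) : S.Xa (c + c') φ = S.Xa c φ + S.Xa c' φ :=
  DFunLike.congr_fun (((S.isDer_Xa (c + c')).ext ((S.isDer_Xa c).add (S.isDer_Xa c'))
    (by simp) (by simp) (by simp))) φ

theorem Xx_add (v w : E) (φ : P) : S.Xx T (v + w) φ = S.Xx T v φ + S.Xx T w φ :=
  DFunLike.congr_fun (((S.isDer_Xx T (v + w)).ext ((S.isDer_Xx T v).add (S.isDer_Xx T w))
    (by simp) (by simp) (by simp [T.nabla.add_right]))) φ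

theorem Xd_add (D D' : Derivation R A A) (φ : P) :
    S.Xd T (D + D') φ = S.Xd T D φ + S.Xd T D' φ :=
  DFunLike.congr_fun (((S.isDer_Xd T (D + D')).ext ((S.isDer_Xd T D).add (S.isDer_Xd T D'))
    (by simp [add_comm]) (by simp [T.nabla.add_left, add_comm])
    (fun D'' => by
      simp only [AddMonoidHom.add_apply, Xd_d, map_add, add_lie]
      abel))) φ

/-- Together with `Xx_smul` and `Xd_smul`, this supplies the conditions of `exists_isDer` when {φ,
·} is defined. In each case both sides are derivations in φ, so generators suffice. -/
theorem Xa_mul (c c' : A) (φ : P) :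
    S.Xa (c * c') φ = S.a c * S.Xa c' φ + S.a c' * S.Xa c φ :=
  DFunLike.congr_fun (((S.isDer_Xa (c * c')).ext
    (((S.isDer_Xa c').mul_left (S.par_a c)).add ((S.isDer_Xa c).mul_left (S.par_a c')))
    (by simp) (by simp) (by simp))) φ

theorem Xx_smul (c : A) (v : E) (φ : P) :
    S.Xx T (c • v) φ = S.a c * S.Xx T v φ + S.x v * S.Xa c φ :=
  DFunLike.congr_fun (((S.isDer_Xx T (c • v)).ext
    (((S.isDer_Xx T v).mul_left (S.par_a c)).add ((S.isDer_Xa c).mul_left (S.par_x v)))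
    (by simp) (by simp)
    (fun D => by simp [T.nabla.leibniz, S.x_smul, S.a_central]))) φ

theorem Xd_smul (c : A) (D : Derivation R A A) (φ : P) :
    S.Xd T (c • D) φ = S.a c * S.Xd T D φ + S.d D * S.Xa c φ := by
  refine DFunLike.congr_fun (((S.isDer_Xd T (c • D)).ext
    (((S.isDer_Xd T D).mul_left (S.par_a c)).add ((S.isDer_Xa c).mul_left (S.par_d D)))
    (by simp) (by simp [T.nabla.smul_left, S.x_smul])
    (fun D' => ?_))) φ
  have h1 : ⁅c • D, D'⁆ = c • ⁅D, D'⁆ - D' c • D := by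
    ext c'
    simp only [Derivation.commutator_apply, Derivation.smul_apply, Derivation.sub_apply,
      Derivation.leibniz, smul_eq_mul]
    ring
  have h2 : T.r (c • D) D' = c • T.r D D' := by
    rw [T.r_neg, T.r_smul, T.r_neg D, smul_neg]
  simp only [AddMonoidHom.add_apply, AddMonoidHom.comp_apply, AddMonoidHom.coe_mulLeft, Xd_d, Xa_d,
    h1, h2, map_sub, S.d_smul, S.j_smul, ← S.a_central (D' c)]
  noncomm_ring

theorem Xa_sigma (c : A) (φ : P) : S.Xa c (S.sigma φ) = S.sigma (S.Xa c φ) := by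
  rw [(S.isDer_Xa c).map_sigma (p := false)] <;> simp [par_zero, par_a]

/-! ### The bracket: Leibniz rules, antisymmetry, degree. -/

/-- The values are those forced by antisymmetry; `sigma` carries the sign (-1)^|φ| met when
exchanging φ with an odd generator. -/
theorem exists_hamiltonian (b : Bool) {φ : P} (hφ : S.Par b φ) : ∃ δ : P →+ P, S.IsDer b δ ∧
    (∀ c, δ (S.a c) = -S.Xa c φ) ∧ (∀ v, δ (S.x v) = -S.Xx T v (S.sigma φ)) ∧
    ∀ D, δ (S.d D) = -S.Xd T D φ := by
  refine exists_isDer S b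
    (AddMonoidHom.mk' (fun c => -S.Xa c φ) fun _ _ => by simp [Xa_add, add_comm])
    (AddMonoidHom.mk' (fun v => -S.Xx T v (S.sigma φ)) fun _ _ => by simp [Xx_add, add_comm])
    (AddMonoidHom.mk' (fun D => -S.Xd T D φ) fun _ _ => by simp [Xd_add, add_comm])
    (fun _ => (S.Xa_par _ hφ).neg)
    (fun _ => (S.Xx_par T _ hφ.sigma).neg) (fun _ => (S.Xd_par T _ hφ).neg)
    (fun c c' => ?_) (fun c v => ?_) (fun c D => ?_)
  · simp only [AddMonoidHom.mk'_apply, Xa_mul, S.a_central c']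
    noncomm_ring
  · simp only [AddMonoidHom.mk'_apply, Xx_smul, x_mul, Xa_sigma, sigma_sigma]
    noncomm_ring
  · simp only [AddMonoidHom.mk'_apply, Xd_smul, S.d_central]
    noncomm_ring

/-- The Hamiltonian derivation of the part of `φ` of parity `b`. -/
def ham (b : Bool) (φ : P) : P →+ P := (S.exists_hamiltonian T b (S.par_part b φ)).choose

theorem isDer_ham (b : Bool) (φ : P) : S.IsDer b (S.ham T b φ) :=
  (S.exists_hamiltonian T b (S.par_part b φ)).choose_spec.1
theorem ham_a (b : Bool) (φ : P) (c : A) : S.ham T b φ (S.a c) = -S.Xa c (S.part b φ) :=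
  (S.exists_hamiltonian T b (S.par_part b φ)).choose_spec.2.1 c
theorem ham_x (b : Bool) (φ : P) (v : E) :
    S.ham T b φ (S.x v) = -S.Xx T v (S.sigma (S.part b φ)) :=
  (S.exists_hamiltonian T b (S.par_part b φ)).choose_spec.2.2.1 v
theorem ham_d (b : Bool) (φ : P) (D : Derivation R A A) :
    S.ham T b φ (S.d D) = -S.Xd T D (S.part b φ) :=
  (S.exists_hamiltonian T b (S.par_part b φ)).choose_spec.2.2.2 D

theorem ham_add (b : Bool) (φ ψ : P) : S.ham T b (φ + ψ) = S.ham T b φ + S.ham T b ψ :=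
  (S.isDer_ham T b _).ext ((S.isDer_ham T b φ).add (S.isDer_ham T b ψ))
    (by simp [ham_a, add_comm]) (by simp [ham_x, add_comm]) (by simp [ham_d, add_comm])

theorem ham_eq_zero (b : Bool) {φ : P} (h : S.part b φ = 0) : S.ham T b φ = 0 :=
  (S.isDer_ham T b φ).ext (isDer_zero b) (by simp [ham_a, h]) (by simp [ham_x, h])
    (by simp [ham_d, h])

/-- The Rothstein bracket. -/
def br : P →+ P →+ P :=
  AddMonoidHom.mk' (fun φ => S.ham T false φ + S.ham T true φ)
    fun φ ψ => by rw [ham_add, ham_add]; abel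

theorem br_of_par {b : Bool} {φ : P} (h : S.Par b φ) : S.br T φ = S.ham T b φ := by
  have := S.part_not_of_par h
  cases b
  · exact (congrArg _ (S.ham_eq_zero T _ this)).trans (add_zero _)
  · exact (congrArg (· + _) (S.ham_eq_zero T _ this)).trans (zero_add _)

variable {S} in
theorem Par.isDer_br {b : Bool} {φ : P} (h : S.Par b φ) : S.IsDer b (S.br T φ) := by
  rw [S.br_of_par T h]; exact S.isDer_ham T b φ

theorem br_apply (φ ψ : P) : S.br T φ ψ = S.ham T false φ ψ + S.ham T true φ ψ := rfl

theorem br_right_a (φ : P) (c : A) : S.br T φ (S.a c) = -S.Xa c φ := by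
  rw [br_apply, ham_a, ham_a, ← neg_add, ← map_add, part_add_part]
theorem br_right_x (φ : P) (v : E) : S.br T φ (S.x v) = -S.Xx T v (S.sigma φ) := by
  rw [br_apply, ham_x, ham_x, ← neg_add, ← map_add, ← map_add, part_add_part]
theorem br_right_d (φ : P) (D : Derivation R A A) : S.br T φ (S.d D) = -S.Xd T D φ := by
  rw [br_apply, ham_d, ham_d, ← neg_add, ← map_add, part_add_part]

/-- `br` is defined through X in the second slot. That X also appears in the first slot is
antisymmetry of the prescribed values on pairs of generators; for `br_x` and `br_d` it needs the
symmetry of `B` and the skewness of `r`. -/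
theorem br_a (c : A) : S.br T (S.a c) = S.Xa c :=
  ((S.par_a c).isDer_br T).ext (S.isDer_Xa c) (by simp [br_right_a]) (by simp [br_right_x])
    (by simp [br_right_d])

theorem br_x (v : E) : S.br T (S.x v) = S.Xx T v :=
  ((S.par_x v).isDer_br T).ext (S.isDer_Xx T v) (by simp [br_right_a])
    (fun w => by simp [br_right_x, T.symm v w]) (by simp [br_right_d])

theorem br_d (D : Derivation R A A) : S.br T (S.d D) = S.Xd T D :=
  ((S.par_d D).isDer_br T).ext (S.isDer_Xd T D) (by simp [br_right_a])
    (by simp [br_right_x]) (fun D' => by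
      rw [br_right_d, Xd_d, Xd_d, ← lie_skew, T.r_neg D', map_neg, map_neg]
      abel)

theorem par_br {b c : Bool} {φ ψ : P} (h : S.Par b φ) (h' : S.Par c ψ) :
    S.Par (b ^^ c) (S.br T φ ψ) := by
  refine (h.isDer_br T).par (fun c => ?_) (fun v => ?_) (fun D => ?_) h'
  · rw [br_right_a]; exact (S.Xa_par c h).neg
  · rw [br_right_x]; exact (S.Xx_par T v h.sigma).neg
  · rw [br_right_d]; exact (S.Xd_par T D h).neg

theorem sigma_br (φ ψ : P) : S.sigma (S.br T φ ψ) = S.br T (S.sigma φ) (S.sigma ψ) := by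
  induction φ using S.par_induction with
  | add φ φ' h h' => simp only [map_add, AddMonoidHom.add_apply, h, h']
  | par b φ h =>
    induction ψ using S.par_induction with
    | add ψ ψ' h h' => simp only [map_add, h, h']
    | par c ψ h' =>
      have := S.par_br T h h'
      unfold Par at *
      rw [h, h', this]
      cases b <;> cases c <;> simp

theorem tw_br (b : Bool) (φ ψ : P) :
    S.tw b (S.br T φ ψ) = S.br T (S.tw b φ) (S.tw b ψ) := by
  cases b
  exacts [rfl, S.sigma_br T φ ψ]

/-- Both sides are derivations in χ with the same twist. On generators the identity is the Leibniz
rule of `Xa`, `Xx`, `Xd`. -/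
theorem br_mul_left {b c : Bool} {φ ψ : P} (h : S.Par b φ) (h' : S.Par c ψ) (χ : P) :
    S.br T (φ * ψ) χ = φ * S.br T ψ χ + S.tw b ψ * S.br T φ χ := by
  have h2 : S.IsDer (b ^^ c) ((AddMonoidHom.mulLeft (S.tw b ψ)).comp (S.br T φ)) :=
    (h.isDer_br T).mul_left (h'.tw b)
  have h3 : S.IsDer (b ^^ c) ((AddMonoidHom.mulLeft φ).comp (S.br T ψ)) := by
    rw [Bool.xor_comm]; exact (h'.isDer_br T).mul_left h
  refine DFunLike.congr_fun (((h.mul h').isDer_br T).ext (h3.add h2)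
    (fun c => ?_) (fun v => ?_) (fun D => ?_)) χ
  · simp only [AddMonoidHom.add_apply, AddMonoidHom.comp_apply, AddMonoidHom.coe_mulLeft,
      br_right_a, S.isDer_Xa c φ ψ, mul_neg, (S.Xa_par c h).mul_comm ψ, tw_false]
    abel
  · simp only [AddMonoidHom.add_apply, AddMonoidHom.comp_apply, AddMonoidHom.coe_mulLeft,
      br_right_x, map_mul, S.isDer_Xx T v _ _, mul_neg, (S.Xx_par T v h.sigma).mul_comm _, tw_true,
      sigma_sigma]
    cases b <;> simp [add_comm]
  · simp only [AddMonoidHom.add_apply, AddMonoidHom.comp_apply, AddMonoidHom.coe_mulLeft,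
      br_right_d, S.isDer_Xd T D φ ψ, mul_neg, (S.Xd_par T D h).mul_comm ψ, tw_false]
    abel

theorem br_antisymm {b : Bool} {φ : P} (h : S.Par b φ) (ψ : P) :
    S.br T φ ψ = -S.br T (S.tw b ψ) φ := by
  refine S.sum_induction (fun ψ => S.br T φ ψ = -S.br T (S.tw b ψ) φ) (fun ψ ψ' h h' => ?_)
    (fun n ψ hψ => ?_) ψ
  · simp only [map_add, AddMonoidHom.add_apply, h, h']; abel
  -- Homogeneous induction is needed because `br_mul_left` asks for factors of definite parity.
  refine S.hom_induction (fun n ψ => S.br T φ ψ = -S.br T (S.tw b ψ) φ) (fun n => by simp)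
    (fun n ψ ψ' h h' => ?_) (fun c => ?_) (fun v => ?_) (fun D => ?_)
    (fun m n ψ ψ' hψ hψ' h1 h2 => ?_) n ψ hψ
  · simp only [map_add, AddMonoidHom.add_apply, h, h']; abel
  · cases b <;> simp [br_right_a, br_a]
  · unfold Par at h
    cases b <;> simp_all [br_right_x, br_x]
  · cases b <;> simp [br_right_d, br_d]
  · have hψ := S.par_of_mem hψ
    have hψ' := S.par_of_mem hψ'
    rw [h.isDer_br T, h1, h2, map_mul, S.br_mul_left T (hψ.tw b) (hψ'.tw b), neg_mul,
      (S.par_br T (hψ.tw b) h).mul_comm ψ', mul_neg, tw_comm _ b, tw_tw,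
      Bool.xor_comm]
    abel

theorem br_mem {m n : ℕ} {φ ψ : P} (hφ : φ ∈ S.G m) (hψ : ψ ∈ S.G n) :
    S.br T φ ψ ∈ S.GZ (m + n - 2) := by
  have hG : ∀ {k : ℕ} {χ : P} (l : ℤ), k = l → χ ∈ S.G k → χ ∈ S.GZ l := fun l h hχ => by
    rwa [← h, GZ_natCast]
  have ha : ∀ c, S.br T φ (S.a c) ∈ S.GZ ((m : ℤ) - 2) := fun c => by
    rw [br_right_a, sub_eq_add_neg]
    refine neg_mem ((S.isDer_Xa c).map_mem (fun _ => ?_) (fun _ => ?_) (fun D => ?_) (hG m rfl hφ))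
    · rw [Xa_a]; exact zero_mem _
    · rw [Xa_x]; exact zero_mem _
    · rw [Xa_d]; exact hG _ (by norm_num) (S.a_mem _)
  have hx : ∀ v, S.br T φ (S.x v) ∈ S.GZ (1 + ((m : ℤ) - 2)) := fun v => by
    rw [br_right_x, show (1 : ℤ) + (m - 2) = m + -1 by ring]
    refine neg_mem ((S.isDer_Xx T v).map_mem (fun _ => ?_) (fun _ => ?_) (fun D => ?_)
      (sigma_mem (hG m rfl hφ)))
    · rw [Xx_a]; exact zero_mem _
    · rw [Xx_x]; exact hG _ (by norm_num) (S.a_mem _)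
    · rw [Xx_d]; exact hG _ (by norm_num) (S.x_mem _)
  have hd : ∀ D, S.br T φ (S.d D) ∈ S.GZ (2 + ((m : ℤ) - 2)) := fun D => by
    rw [br_right_d, show (2 : ℤ) + (m - 2) = m + 0 by ring]
    refine neg_mem ((S.isDer_Xd T D).map_mem (fun _ => ?_) (fun _ => ?_) (fun D => ?_)
      (hG m rfl hφ))
    · rw [Xd_a]; exact neg_mem (hG _ (by norm_num) (S.a_mem _))
    · rw [Xd_x]; exact neg_mem (hG _ (by norm_num) (S.x_mem _))
    · rw [Xd_d]
      exact sub_mem (neg_mem (hG _ (by norm_num) (S.d_mem _))) (hG _ (by norm_num) (S.j_mem _))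
  rw [show (m : ℤ) + n - 2 = n + (m - 2) by ring]
  exact ((S.par_of_mem hφ).isDer_br T).map_mem ha hx hd (hG n rfl hψ)

end GradedPresentation

/-! ### The graded Jacobi identity. -/

namespace GradedPresentation

variable {R A E : Type*} {P : Type u} [CommRing R] [CommRing A] [Algebra R A]
    [AddCommGroup E] [Module A E] [Ring P] (S : GradedPresentation R A E P)
    (T : CurvedConnection R A E)

/-- The graded Jacobi identity for `φ` of parity `b`. -/
def Jac (b : Bool) (φ ψ χ : P) : Prop :=
  S.br T φ (S.br T ψ χ) = S.br T (S.br T φ ψ) χ + S.br T (S.tw b ψ) (S.br T φ χ)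

variable {S} in
theorem Par.tw_eq {b : Bool} {φ : P} (h : S.Par b φ) (c : Bool) :
    S.tw c φ = bif b && c then -φ else φ := by
  unfold Par at h
  cases b <;> cases c <;> simp_all

variable {S T} in
theorem Jac.add_right {b : Bool} {φ ψ χ χ' : P} (h : S.Jac T b φ ψ χ) (h' : S.Jac T b φ ψ χ') :
    S.Jac T b φ ψ (χ + χ') := by
  unfold Jac at *
  simp only [map_add, h, h']
  abel

variable {S T} in
theorem Jac.mul_right {b c : Bool} {φ ψ χ χ' : P} (hφ : S.Par b φ) (hψ : S.Par c ψ)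
    (h : S.Jac T b φ ψ χ) (h' : S.Jac T b φ ψ χ') : S.Jac T b φ ψ (χ * χ') := by
  unfold Jac at *
  have h1 := hφ.isDer_br T
  have h2 := hψ.isDer_br T
  have h3 := (hψ.tw b).isDer_br T
  have h4 := (S.par_br T hφ hψ).isDer_br T
  have e1 := S.tw_br T b ψ χ
  have e2 := S.tw_br T c φ χ
  rw [h2, map_add, h1, h1, h, h', h4, h1, map_add, h3, h3, tw_comm b c, tw_tw]
  -- The unwanted cross terms agree: twisting φ by `c` and twisting ψ by `b` both produce the sign
  -- (-1)^(bc).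
  have e3 : S.br T φ (S.tw c χ) * S.br T ψ χ' =
      S.tw c (S.br T φ χ) * S.br T (S.tw b ψ) χ' := by
    rw [e2, hφ.tw_eq, hψ.tw_eq, Bool.and_comm]
    cases c && b <;> simp
  rw [e1, e3, Bool.xor_comm c b]
  noncomm_ring

variable {S T} in
theorem Jac.swap_left {b c : Bool} {φ ψ χ : P} (hφ : S.Par b φ) (hψ : S.Par c ψ)
    (h : S.Jac T b φ ψ χ) : S.Jac T c ψ φ χ := by
  unfold Jac at *
  rw [S.br_antisymm T hψ φ, hφ.tw_eq]
  rw [hψ.tw_eq, Bool.and_comm] at h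
  revert h
  cases b && c <;> intro h <;> simp at h <;> simp [h]

variable {S T} in
theorem Jac.swap_right {b c d : Bool} {φ ψ χ : P} (hφ : S.Par b φ) (hψ : S.Par c ψ)
    (hχ : S.Par d χ) (h : S.Jac T b φ ψ χ) : S.Jac T b φ χ ψ := by
  unfold Jac at *
  rw [S.br_antisymm T hχ ψ, S.br_antisymm T (S.par_br T hφ hχ) ψ,
    S.br_antisymm T (hχ.tw b) (S.br T φ ψ), hψ.tw_eq, hψ.tw_eq, hχ.tw_eq,
    (S.par_br T hφ hψ).tw_eq]
  rw [hψ.tw_eq] at h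
  cases b <;> cases c <;> cases d <;> simp_all [add_comm]

theorem jac_of_generators {b c : Bool} {φ ψ : P} (hφ : S.Par b φ) (hψ : S.Par c ψ)
    (a : ∀ e, S.Jac T b φ ψ (S.a e)) (x : ∀ v, S.Jac T b φ ψ (S.x v))
    (d : ∀ D, S.Jac T b φ ψ (S.d D)) (χ : P) : S.Jac T b φ ψ χ := by
  induction χ using S.induction with
  | add χ χ' h h' => exact h.add_right h'
  | a e => exact a e
  | x v => exact x v
  | d D => exact d D
  | mul χ χ' h h' => exact Jac.mul_right hφ hψ h h'

theorem wedgePairing_add (B : LinearMap.BilinForm A E) (ω ω' : ⋀[A]^2 E) (v w : E) :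
    wedgePairing B (ω + ω') v w = wedgePairing B ω v w + wedgePairing B ω' v w := by
  simp [wedgePairing]

theorem wedgePairing_smul (B : LinearMap.BilinForm A E) (c : A) (ω : ⋀[A]^2 E) (v w : E) :
    wedgePairing B (c • ω) v w = c * wedgePairing B ω v w := by
  simp [wedgePairing]

@[simp] theorem Xa_j (c : A) (ω : ⋀[A]^2 E) : S.Xa c (S.j ω) = 0 := by
  induction ω using wedge_induction with
  | add ω ω' h h' => rw [map_add, map_add, h, h', add_zero]
  | smul e v w => simp [S.j_smul, S.j_wedge, S.isDer_Xa c _ _]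

/-- Bracketing with `v` contracts: {v, u ∧ w} = ⟨v, u⟩w - ⟨v, w⟩u. The pairing with `z`
characterises the resulting vector. -/
theorem exists_Xx_j (v : E) (ω : ⋀[A]^2 E) :
    ∃ y, S.Xx T v (S.j ω) = S.x y ∧ ∀ z, T.B y z = wedgePairing T.B ω v z := by
  induction ω using wedge_induction with
  | add ω ω' h h' =>
    obtain ⟨y, h1, h2⟩ := h
    obtain ⟨y', h1', h2'⟩ := h'
    exact ⟨y + y', by rw [map_add, map_add, map_add, h1, h1'], fun z => by
      rw [map_add, LinearMap.add_apply, h2, h2', wedgePairing_add]⟩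
  | smul e u w =>
    refine ⟨e • (T.B u v • w - T.B w v • u), ?_, fun z => ?_⟩
    · simp only [S.j_smul, S.j_wedge, S.isDer_Xx T v _ _, Xx_a, Xx_x, S.x_smul, map_sub,
        T.symm v, tw_true, sigma_a, sigma_x, ← S.a_central (T.B w v)]
      noncomm_ring
    · simp [wedgePairing_smul, wedgePairing_ιMulti]

/-- The 2-vector is minus the covariant derivative of ω; the Jacobi identity only needs that the
bracket stays in the image of `j`. -/
theorem exists_Xd_j (D : Derivation R A A) (ω : ⋀[A]^2 E) :
    ∃ ω', S.Xd T D (S.j ω) = S.j ω' := by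
  induction ω using wedge_induction with
  | add ω ω' h h' =>
    obtain ⟨y, h1⟩ := h
    obtain ⟨y', h1'⟩ := h'
    exact ⟨y + y', by rw [map_add, map_add, map_add, h1, h1']⟩
  | smul e u w =>
    refine ⟨-(D e • exteriorPower.ιMulti A 2 ![u, w] +
      e • (exteriorPower.ιMulti A 2 ![T.nabla.cov D u, w] +
      exteriorPower.ιMulti A 2 ![u, T.nabla.cov D w])), ?_⟩
    simp only [S.j_smul, S.j_wedge, S.isDer_Xd T D _ _, Xd_a, Xd_x, map_add, map_neg, tw_false]
    noncomm_ring

theorem Xx_r (v : E) (D D' : Derivation R A A) :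
    S.Xx T v (S.j (T.r D D')) = S.x (T.nabla.curvature D D' v) := by
  obtain ⟨y, h1, h2⟩ := S.exists_Xx_j T v (T.r D D')
  rw [h1]
  congr 1
  refine sub_eq_zero.1 (T.nondegenerate _ fun w => ?_)
  rw [map_sub, LinearMap.sub_apply, h2, T.r_spec, sub_self]

theorem j_eq_zero {ω : ⋀[A]^2 E} (h : ∀ v, S.Xx T v (S.j ω) = 0) : ω = 0 := by
  refine T.wedge_ext ω fun v w => S.a_injective ?_
  obtain ⟨y, h1, h2⟩ := S.exists_Xx_j T v ω
  rw [← h2, T.symm, ← Xx_x (S := S), ← h1, h, map_zero, map_zero]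

theorem jac_a_a (c e : A) (χ : P) : S.Jac T false (S.a c) (S.a e) χ :=
  S.jac_of_generators T (S.par_a c) (S.par_a e) (by simp [Jac, br_a]) (by simp [Jac, br_a])
    (by simp [Jac, br_a]) χ

theorem jac_a_x (c : A) (v : E) (χ : P) : S.Jac T false (S.a c) (S.x v) χ :=
  S.jac_of_generators T (S.par_a c) (S.par_x v) (by simp [Jac, br_a, br_x])
    (by simp [Jac, br_a, br_x]) (by simp [Jac, br_a, br_x]) χ

theorem jac_a_d (c : A) (D : Derivation R A A) (χ : P) : S.Jac T false (S.a c) (S.d D) χ :=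
  S.jac_of_generators T (S.par_a c) (S.par_d D) (by simp [Jac, br_a, br_d])
    (by simp [Jac, br_a, br_d])
    (fun D' => by simp [Jac, br_a, br_d, Derivation.commutator_apply, sub_eq_add_neg]) χ

/-- The only nontrivial generator is `d D`, where the identity says that ∇ is metric. -/
theorem jac_x_x (v w : E) (χ : P) : S.Jac T true (S.x v) (S.x w) χ :=
  S.jac_of_generators T (S.par_x v) (S.par_x w) (by simp [Jac, br_a, br_x])
    (by simp [Jac, br_a, br_x]) (fun D => by
      have h := T.metric D v w
      simp [Jac, br_a, br_x, h, T.symm w]) χ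

/-- On `x w` this is the metric property; on `d D'` it is the definition of the curvature, by
`Xx_r`. -/
theorem jac_x_d (v : E) (D : Derivation R A A) (χ : P) : S.Jac T true (S.x v) (S.d D) χ :=
  S.jac_of_generators T (S.par_x v) (S.par_d D) (by simp [Jac, br_d, br_x])
    (fun w => by
      have h := T.metric D v w
      simp [Jac, br_d, br_x, h]) (fun D' => by
      simp [Jac, br_d, br_x, Xx_r, Connection.curvature]; abel) χ

theorem jac_d_d_a (D D' : Derivation R A A) (c : A) :
    S.Jac T false (S.d D) (S.d D') (S.a c) := by
  simp [Jac, br_right_a, br_d, Derivation.commutator_apply]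

theorem jac_d_d_x (D D' : Derivation R A A) (v : E) :
    S.Jac T false (S.d D) (S.d D') (S.x v) := by
  have h := (S.par_j (T.r D D')).even
  simp [Jac, br_right_x, br_d, h, Xx_r, Connection.curvature]

theorem jac_d_j_x (D : Derivation R A A) (ω : ⋀[A]^2 E) (v : E) :
    S.Jac T false (S.d D) (S.j ω) (S.x v) :=
  Jac.swap_right (S.par_d D) (S.par_x v) (S.par_j ω)
    (Jac.swap_left (S.par_x v) (S.par_d D) (S.jac_x_d T v D _))

/-- This is the second Bianchi identity. The Jacobiator has no `d` component, by the Jacobi identity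
for derivations of `A`, so it is `j ω`. Its bracket with each `x v` is a Jacobi sum of commutators
of the operators {D, ·} on `E`, hence zero, and contractions detect 2-vectors (`j_eq_zero`). -/
theorem jac_d_d_d (D D' D'' : Derivation R A A) :
    S.Jac T false (S.d D) (S.d D') (S.d D'') := by
  have h0 : ∀ D w, S.br T (S.d D) (S.x w) = -S.x (T.nabla.cov D w) := fun D w => by
    rw [br_d, Xd_x]
  have h1 : ∀ D D' w, S.br T (S.br T (S.d D) (S.d D')) (S.x w) =
      S.br T (S.d D) (S.br T (S.d D') (S.x w)) - S.br T (S.d D') (S.br T (S.d D) (S.x w)) :=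
    fun D D' w => eq_sub_of_add_eq (S.jac_d_d_x T D D' w).symm
  -- Expand {D', D''} into its `d` and `j` parts and use the Jacobi identity on `x w` for each.
  have h2 : ∀ D D' D'' w, S.br T (S.br T (S.d D) (S.br T (S.d D') (S.d D''))) (S.x w) =
      S.br T (S.d D) (S.br T (S.br T (S.d D') (S.d D'')) (S.x w)) -
        S.br T (S.br T (S.d D') (S.d D'')) (S.br T (S.d D) (S.x w)) := by
    intro D D' D'' w
    have k1 : S.br T (S.d D') (S.d D'') = -S.d ⁅D', D''⁆ - S.j (T.r D' D'') := by
      rw [br_d, Xd_d]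
    have k2 : S.br T (S.d D) (S.br T (S.d ⁅D', D''⁆) (S.x w)) = _ :=
      S.jac_d_d_x T D ⁅D', D''⁆ w
    have k3 : S.br T (S.d D) (S.br T (S.j (T.r D' D'')) (S.x w)) = _ :=
      S.jac_d_j_x T D (T.r D' D'') w
    rw [k1]
    simp only [map_neg, map_sub, AddMonoidHom.neg_apply, AddMonoidHom.sub_apply, k2, k3, tw_false]
    abel
  have h3 : ∀ D D' D'', S.br T (S.br T (S.d D) (S.d D')) (S.d D'') =
      -S.br T (S.d D'') (S.br T (S.d D) (S.d D')) := fun D D' D'' =>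
    S.br_antisymm T (S.par_br T (S.par_d D) (S.par_d D')) _
  have h4 : ∀ D D' D'', ∃ ω, S.br T (S.d D) (S.br T (S.d D') (S.d D'')) =
      S.d ⁅D, ⁅D', D''⁆⁆ + S.j ω := fun D D' D'' => by
    obtain ⟨ω, hω⟩ := S.exists_Xd_j T D (T.r D' D'')
    refine ⟨T.r D ⁅D', D''⁆ - ω, ?_⟩
    simp only [br_d, Xd_d, map_neg, map_sub, hω]
    abel
  obtain ⟨ω₁, e1⟩ := h4 D D' D''
  obtain ⟨ω₂, e2⟩ := h4 D'' D D'
  obtain ⟨ω₃, e3⟩ := h4 D' D D''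
  have key : S.br T (S.d D) (S.br T (S.d D') (S.d D'')) + S.br T (S.d D'') (S.br T (S.d D) (S.d D'))
      - S.br T (S.d D') (S.br T (S.d D) (S.d D'')) = S.j (ω₁ + ω₂ - ω₃) := by
    rw [e1, e2, e3, map_sub, map_add, show ⁅D, ⁅D', D''⁆⁆ = ⁅D', ⁅D, D''⁆⁆ - ⁅D'', ⁅D, D'⁆⁆ by
      rw [← lie_skew D'', sub_neg_eq_add, add_comm, ← leibniz_lie D D' D''], map_sub]
    abel
  have hω : ω₁ + ω₂ - ω₃ = 0 := by
    refine S.j_eq_zero T fun v => ?_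
    rw [← neg_eq_zero, ← (S.par_j (ω₁ + ω₂ - ω₃)).even, ← br_right_x, ← key]
    simp only [map_add, map_sub, AddMonoidHom.add_apply, AddMonoidHom.sub_apply, h2, h1, h0,
      map_neg, neg_neg]
    abel
  rw [Jac, h3, tw_false, ← sub_eq_zero]
  rw [hω, map_zero] at key
  rw [← key]
  abel

theorem jac_d_d (D D' : Derivation R A A) (χ : P) : S.Jac T false (S.d D) (S.d D') χ :=
  S.jac_of_generators T (S.par_d D) (S.par_d D') (S.jac_d_d_a T D D') (S.jac_d_d_x T D D')
    (S.jac_d_d_d T D D') χ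

/-- To be one of the generators, of parity `b`. -/
inductive IsGenerator : Bool → P → Prop
  | a (c : A) : IsGenerator false (S.a c)
  | x (v : E) : IsGenerator true (S.x v)
  | d (D : Derivation R A A) : IsGenerator false (S.d D)

variable {S}

theorem IsGenerator.par {b : Bool} {φ : P} (h : S.IsGenerator b φ) : S.Par b φ := by
  cases h
  exacts [S.par_a _, S.par_x _, S.par_d _]

theorem jac_generators {b c : Bool} {φ ψ : P} (hφ : S.IsGenerator b φ) (hψ : S.IsGenerator c ψ)
    (χ : P) : S.Jac T b φ ψ χ := by
  cases hφ with
  | a e =>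
    cases hψ with
    | a e' => exact S.jac_a_a T e e' χ
    | x v => exact S.jac_a_x T e v χ
    | d D => exact S.jac_a_d T e D χ
  | x v =>
    cases hψ with
    | a e' => exact Jac.swap_left (S.par_a e') (S.par_x v) (S.jac_a_x T e' v χ)
    | x w => exact S.jac_x_x T v w χ
    | d D => exact S.jac_x_d T v D χ
  | d D =>
    cases hψ with
    | a e' => exact Jac.swap_left (S.par_a e') (S.par_d D) (S.jac_a_d T e' D χ)
    | x w => exact Jac.swap_left (S.par_x w) (S.par_d D) (S.jac_x_d T w D χ)
    | d D' => exact S.jac_d_d T D D' χ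

theorem jac_of_isGenerator {b c : Bool} {φ ψ : P} (hφ : S.Par b φ) (hψ : S.Par c ψ)
    (h : ∀ d χ, S.IsGenerator d χ → S.Jac T b φ ψ χ) (χ : P) : S.Jac T b φ ψ χ :=
  S.jac_of_generators T hφ hψ (fun _ => h _ _ (.a _)) (fun _ => h _ _ (.x _))
    (fun _ => h _ _ (.d _)) χ

/-- The graded Jacobi identity. -/
theorem jac {b c : Bool} {φ ψ : P} (hφ : S.Par b φ) (hψ : S.Par c ψ) (χ : P) :
    S.Jac T b φ ψ χ := by
  -- A slot is freed by reducing the third entry to a generator and permuting it forward: two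
  -- generators suffice in `jac_generators`, then one here, then none.
  have h1 : ∀ {b c : Bool} {φ ψ : P}, S.IsGenerator b φ → S.Par c ψ → ∀ χ, S.Jac T b φ ψ χ :=
    fun hφ hψ => jac_of_isGenerator T hφ.par hψ fun _ χ hχ =>
      Jac.swap_right hφ.par hχ.par hψ (jac_generators T hφ hχ _)
  exact jac_of_isGenerator T hφ hψ (fun d χ hχ =>
    Jac.swap_right hφ hχ.par hψ (Jac.swap_left hχ.par hφ (h1 hχ hφ ψ))) χ

theorem neg_one_pow_eq_cond (n : ℕ) : (-1 : P) ^ n = bif n.bodd then -1 else 1 := by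
  cases h : n.bodd
  · exact Even.neg_one_pow (by rw [Nat.even_iff, Nat.mod_two_of_bodd, h]; rfl)
  · exact Odd.neg_one_pow (by rw [Nat.odd_iff, Nat.mod_two_of_bodd, h]; rfl)

theorem tw_of_mem {m n : ℕ} {φ : P} (hφ : φ ∈ S.G n) :
    S.tw m.bodd φ = (-1) ^ (m * n) * φ := by
  rw [(S.par_of_mem hφ).tw_eq, neg_one_pow_eq_cond, Nat.bodd_mul, Bool.and_comm]
  cases m.bodd && n.bodd <;> simp

/-- Elements killed by all derivations are Casimirs. Applied to the image of `R`, this makes the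
bracket `R`-bilinear. -/
theorem Xa_eq_zero {c : A} (hc : ∀ D : Derivation R A A, D c = 0) : S.Xa c = 0 :=
  (S.isDer_Xa c).ext (isDer_zero _) (by simp) (by simp) (by simp [hc])

theorem br_const_mul_right {c : A} (hc : ∀ D : Derivation R A A, D c = 0) (φ ψ : P) :
    S.br T φ (S.a c * ψ) = S.a c * S.br T φ ψ := by
  induction φ using S.par_induction with
  | add φ φ' h h' => simp only [map_add, AddMonoidHom.add_apply, h, h', mul_add]
  | par b φ h =>
    rw [h.isDer_br T, br_right_a, Xa_eq_zero hc]
    cases b <;> simp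

theorem br_const_mul_left {c : A} (hc : ∀ D : Derivation R A A, D c = 0) (φ ψ : P) :
    S.br T (S.a c * φ) ψ = S.a c * S.br T φ ψ := by
  induction φ using S.par_induction with
  | add φ φ' h h' => simp only [map_add, AddMonoidHom.add_apply, h, h', mul_add]
  | par b φ h =>
    rw [S.br_mul_left T (S.par_a c) h, br_a, Xa_eq_zero hc]
    simp

/-- A graded antisymmetric biderivation which agrees with the Rothstein bracket on generators
is the Rothstein bracket. -/
theorem br_unique (br' : P →+ P →+ P)
    (antisymm : ∀ m n φ ψ, φ ∈ S.G m → ψ ∈ S.G n → br' φ ψ = -((-1) ^ (m * n) * br' ψ φ))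
    (leibniz : ∀ m n φ ψ χ, φ ∈ S.G m → ψ ∈ S.G n →
      br' φ (ψ * χ) = br' φ ψ * χ + (-1) ^ (m * n) * (ψ * br' φ χ))
    (aa : ∀ c e, br' (S.a c) (S.a e) = 0) (ax : ∀ c v, br' (S.a c) (S.x v) = 0)
    (xx : ∀ v w, br' (S.x v) (S.x w) = S.a (T.B v w))
    (da : ∀ D c, br' (S.d D) (S.a c) = -S.a (D c))
    (dx : ∀ D v, br' (S.d D) (S.x v) = -S.x (T.nabla.cov D v))
    (dd : ∀ D D', br' (S.d D) (S.d D') = -S.d ⁅D, D'⁆ - S.j (T.r D D')) :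
    br' = S.br T := by
  have der : ∀ m φ, φ ∈ S.G m → S.IsDer m.bodd (br' φ) := by
    intro m φ hφ ψ χ
    refine S.sum_induction (fun ψ => br' φ (ψ * χ) = br' φ ψ * χ + S.tw m.bodd ψ * br' φ χ)
      (fun ψ ψ' h h' => ?_) (fun n ψ hψ => ?_) ψ
    · simp only [add_mul, map_add, h, h']
      abel
    · rw [leibniz m n φ ψ χ hφ hψ, tw_of_mem hψ, mul_assoc]
  have anti : ∀ m φ, φ ∈ S.G m → ∀ ψ, br' φ ψ = -br' (S.tw m.bodd ψ) φ := by
    intro m φ hφ ψ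
    refine S.sum_induction (fun ψ => br' φ ψ = -br' (S.tw m.bodd ψ) φ)
      (fun ψ ψ' h h' => ?_) (fun n ψ hψ => ?_) ψ
    · simp only [map_add, h, h', AddMonoidHom.add_apply]
      abel
    · rw [antisymm m n φ ψ hφ hψ, tw_of_mem hψ]
      rcases neg_one_pow_eq_or P (m * n) with h | h <;> simp [h]
  -- With a generator in the first slot both brackets are derivations, hence compared on generators;
  -- afterwards antisymmetry reduces a general first slot to this case.
  have ea : ∀ c, br' (S.a c) = S.br T (S.a c) := fun c =>
    (der 0 _ (S.a_mem c)).ext ((S.par_a c).isDer_br T) (by simp [br_a, aa]) (by simp [br_a, ax])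
      (fun D => by rw [anti 0 _ (S.a_mem c)]; simp [br_a, da])
  have ex : ∀ v, br' (S.x v) = S.br T (S.x v) := fun v =>
    (der 1 _ (S.x_mem v)).ext ((S.par_x v).isDer_br T)
      (fun c => by rw [anti 1 _ (S.x_mem v)]; simp [br_x, ax]) (by simp [br_x, xx])
      (fun D => by rw [anti 1 _ (S.x_mem v)]; simp [br_x, dx])
  have ed : ∀ D, br' (S.d D) = S.br T (S.d D) := fun D =>
    (der 2 _ (S.d_mem D)).ext ((S.par_d D).isDer_br T)
      (by simp [br_d, da]) (by simp [br_d, dx]) (by simp [br_d, dd])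
  ext φ : 1
  refine S.sum_induction (fun φ => br' φ = S.br T φ) (fun φ ψ h h' => by
    rw [map_add, map_add, h, h']) (fun n φ hφ => ?_) φ
  refine (der n φ hφ).ext ((S.par_of_mem hφ).isDer_br T) (fun c => ?_) (fun v => ?_) (fun D => ?_)
  · rw [anti n φ hφ, S.br_antisymm T (S.par_of_mem hφ), (S.par_a c).tw_eq]
    simp [ea]
  · rw [anti n φ hφ, S.br_antisymm T (S.par_of_mem hφ), (S.par_x v).tw_eq]
    cases n.bodd <;> simp [ex]
  · rw [anti n φ hφ, S.br_antisymm T (S.par_of_mem hφ), (S.par_d D).tw_eq]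
    simp [ed]

end GradedPresentation

/-! ### The Rothstein algebra satisfies the presentation. -/

section Model

variable (R A E : Type*) [CommRing R] [CommRing A] [Algebra R A] [AddCommGroup E] [Module A E]

theorem exists_liftAlgHom {T : Type*} [Ring T] [Algebra A T] (fx : E →ₗ[A] T)
    (fd : Derivation R A A →ₗ[A] T) (hd : ∀ D D', Commute (fd D) (fd D'))
    (hdx : ∀ D v, Commute (fd D) (fx v)) (hx : ∀ v, fx v * fx v = 0) :
    ∃ F : RothsteinAlgebra R A E →ₐ[A] T, (∀ v, F (ofModule R v) = fx v) ∧
      ∀ D, F (ofDer E D) = fd D := by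
  -- The symmetric algebra lifts only to commutative targets, so its map is built into the
  -- subalgebra generated by the commuting `fd D`.
  have hmul := Algebra.isMulCommutative_adjoin A (s := Set.range fd)
    (by rintro _ ⟨D, rfl⟩ _ ⟨D', rfl⟩; exact hd D D')
  let : CommRing (Algebra.adjoin A (Set.range fd)) :=
    { (inferInstance : Ring (Algebra.adjoin A (Set.range fd))) with mul_comm := mul_comm' }
  let gd : Derivation R A A →ₗ[A] Algebra.adjoin A (Set.range fd) :=
    LinearMap.codRestrict (Subalgebra.toSubmodule (Algebra.adjoin A (Set.range fd))) fd
      fun D => Algebra.subset_adjoin ⟨D, rfl⟩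
  let f₁ : SymmetricAlgebra A (Derivation R A A) →ₐ[A] T :=
    (Subalgebra.val _).comp (SymmetricAlgebra.lift gd)
  let f₂ : ExteriorAlgebra A E →ₐ[A] T := ExteriorAlgebra.lift A ⟨fx, hx⟩
  have h₁ : ∀ D, f₁ (SymmetricAlgebra.ι A _ D) = fd D := fun D => by
    simp only [f₁, AlgHom.comp_apply, SymmetricAlgebra.lift_ι_apply]
    rfl
  have h₂ : ∀ v, f₂ (ExteriorAlgebra.ι A v) = fx v := fun v => by
    simp [f₂]
  have hcomm : ∀ p ξ, Commute (f₁ p) (f₂ ξ) := by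
    intro p ξ
    induction p using SymmetricAlgebra.induction with
    | algebraMap c => rw [AlgHom.commutes]; exact Algebra.commute_algebraMap_left _ _
    | ι D =>
      rw [h₁]
      induction ξ using ExteriorAlgebra.induction with
      | algebraMap c => rw [AlgHom.commutes]; exact Algebra.commute_algebraMap_right _ _
      | ι v => rw [h₂]; exact hdx D v
      | mul ξ η h h' => rw [map_mul]; exact h.mul_right h'
      | add ξ η h h' => rw [map_add]; exact h.add_right h'
    | mul p q h h' => rw [map_mul]; exact h.mul_left h'
    | add p q h h' => rw [map_add]; exact h.add_left h'
  refine ⟨Algebra.TensorProduct.lift f₁ f₂ hcomm, fun v => ?_, fun D => ?_⟩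
  · simp [ofModule, ofExterior, h₂]
  · simp [ofDer, h₁]

theorem exists_liftRingHom {T : Type*} [Ring T] (fa : A →+* T) (fx : E →+ T)
    (fd : Derivation R A A →+ T) (hx : ∀ c v, fx (c • v) = fa c * fx v)
    (hd : ∀ (c : A) D, fd (c • D) = fa c * fd D) (hax : ∀ c v, Commute (fa c) (fx v))
    (had : ∀ c D, Commute (fa c) (fd D)) (hdd : ∀ D D', Commute (fd D) (fd D'))
    (hdx : ∀ D v, Commute (fd D) (fx v)) (hxx : ∀ v, fx v * fx v = 0) :
    ∃ F : RothsteinAlgebra R A E →+* T, (∀ c, F (ofScalar R c) = fa c) ∧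
      (∀ v, F (ofModule R v) = fx v) ∧ ∀ D, F (ofDer E D) = fd D := by
  -- `fa` need not be central in `T`, but it is central in the centralizer of its range, which also
  -- contains all `fx v` and `fd D`; this makes `C` an `A`-algebra.
  let C : Subring T := Subring.centralizer (Set.range fa)
  have mem : ∀ {t : T}, (∀ c, Commute (fa c) t) → t ∈ C := fun h => by
    rw [Subring.mem_centralizer_iff]
    rintro _ ⟨c, rfl⟩
    exact h c
  let ga : A →+* C := fa.codRestrict C fun c => mem fun e => by
    rw [commute_iff_eq, ← map_mul, mul_comm, map_mul]
  let := ga.toAlgebra' fun c t => Subtype.ext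
    ((Subring.mem_centralizer_iff.1 t.2 _ ⟨c, rfl⟩))
  have smul_def : ∀ (c : A) (t : C), c • t = ga c * t := fun c t => Algebra.smul_def c t
  let gx : E →ₗ[A] C :=
    { toFun := fun v => ⟨fx v, mem fun c => hax c v⟩
      map_add' := fun v w => Subtype.ext (map_add fx v w)
      map_smul' := fun c v => by
        rw [RingHom.id_apply, smul_def]
        exact Subtype.ext (hx c v) }
  let gd : Derivation R A A →ₗ[A] C :=
    { toFun := fun v => ⟨fd v, mem fun c => had c v⟩
      map_add' := fun v w => Subtype.ext (map_add fd v w)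
      map_smul' := fun c v => by
        rw [RingHom.id_apply, smul_def]
        exact Subtype.ext (hd c v) }
  obtain ⟨F, Fx, Fd⟩ := exists_liftAlgHom R A E gx gd (fun D D' => Subtype.ext (hdd D D'))
    (fun D v => Subtype.ext (hdx D v)) (fun v => Subtype.ext (hxx v))
  refine ⟨C.subtype.comp F.toRingHom, fun c => ?_, fun v => ?_, fun D => ?_⟩
  · exact congrArg Subtype.val (F.commutes c)
  · exact congrArg Subtype.val (Fx v)
  · exact congrArg Subtype.val (Fd D)

variable {R A E}

theorem grading_induction {C : RothsteinAlgebra R A E → Prop} {n : ℕ} (zero : C 0)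
    (add : ∀ φ ψ, C φ → C ψ → C (φ + ψ))
    (tmul : ∀ p k, 2 * p + k = n → ∀ q ∈ symPower R A p, ∀ ξ ∈ ⋀[A]^k E, C (q ⊗ₜ[A] ξ))
    {φ : RothsteinAlgebra R A E} (hφ : φ ∈ rothsteinGrading R A E n) : C φ := by
  have h : ∀ p k, 2 * p + k = n → ∀ φ ∈ Submodule.map₂ (TensorProduct.mk A _ _) (symPower R A p)
      (⋀[A]^k E), C φ := by
    intro p k hpk φ hφ
    rw [Submodule.map₂_eq_span_image2] at hφ
    suffices ∀ c : A, C (c • φ) by simpa using this 1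
    induction hφ using Submodule.span_induction with
    | mem φ h =>
      obtain ⟨q, hq, ξ, hξ, rfl⟩ := h
      intro c
      exact tmul p k hpk (c • q) (Submodule.smul_mem _ c hq) ξ hξ
    | zero => intro c; simpa using zero
    | add φ ψ _ _ h h' => intro c; rw [smul_add]; exact add _ _ (h c) (h' c)
    | smul c φ _ h => intro e; rw [smul_smul]; exact h _
  refine Submodule.iSup_induction _ (motive := C) hφ (fun p φ hφ => ?_) zero add
  refine Submodule.iSup_induction _ (motive := C) hφ (fun k φ hφ => ?_) zero add
  exact Submodule.iSup_induction _ (motive := C) hφ (fun hpk φ hφ => h p k hpk φ hφ) zero add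

theorem tmul_mem_grading {p k n : ℕ} (h : 2 * p + k = n)
    {q : SymmetricAlgebra A (Derivation R A A)}
    (hq : q ∈ symPower R A p) {ξ : ExteriorAlgebra A E} (hξ : ξ ∈ ⋀[A]^k E) :
    q ⊗ₜ[A] ξ ∈ rothsteinGrading R A E n :=
  Submodule.mem_iSup_of_mem p (Submodule.mem_iSup_of_mem k (Submodule.mem_iSup_of_mem h
    (Submodule.apply_mem_map₂ (TensorProduct.mk A _ _) hq hξ)))

theorem one_mem_symPower : (1 : SymmetricAlgebra A (Derivation R A A)) ∈ symPower R A 0 := by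
  rw [symPower, pow_zero]; exact Submodule.one_le.1 le_rfl

theorem one_mem_exteriorPower : (1 : ExteriorAlgebra A E) ∈ ⋀[A]^0 E := by
  rw [ExteriorAlgebra.exteriorPower, pow_zero]; exact Submodule.one_le.1 le_rfl

theorem ofScalar_eq (c : A) :
    (ofScalar R c : RothsteinAlgebra R A E) = algebraMap A _ c ⊗ₜ[A] 1 := rfl

theorem smul_eq_ofScalar_mul (r : R) (φ : RothsteinAlgebra R A E) :
    r • φ = ofScalar R (algebraMap R A r) * φ := by
  rw [ofScalar, ← Algebra.smul_def, algebraMap_smul]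

theorem ofScalar_eq_right (c : A) :
    (ofScalar R c : RothsteinAlgebra R A E) = ofExterior R (algebraMap A _ c) := by
  rw [ofScalar_eq, ofExterior, Algebra.algebraMap_eq_smul_one, Algebra.algebraMap_eq_smul_one,
    TensorProduct.smul_tmul]

theorem ofScalar_mem (c : A) : ofScalar R c ∈ rothsteinGrading R A E 0 := by
  rw [ofScalar_eq, Algebra.algebraMap_eq_smul_one]
  exact tmul_mem_grading (p := 0) (k := 0) (by norm_num) (Submodule.smul_mem _ c one_mem_symPower) one_mem_exteriorPower

theorem ofExterior_mem {k : ℕ} {ξ : ExteriorAlgebra A E} (hξ : ξ ∈ ⋀[A]^k E) :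
    ofExterior R ξ ∈ rothsteinGrading R A E k :=
  tmul_mem_grading (p := 0) (k := k) (by ring) one_mem_symPower hξ

theorem ofModule_mem (v : E) : ofModule R v ∈ rothsteinGrading R A E 1 :=
  ofExterior_mem (by rw [ExteriorAlgebra.exteriorPower, pow_one]; exact ⟨v, rfl⟩)

theorem ofDer_mem (D : Derivation R A A) : ofDer E D ∈ rothsteinGrading R A E 2 :=
  tmul_mem_grading (p := 1) (k := 0) (by norm_num) (by rw [symPower, pow_one]; exact ⟨D, rfl⟩) one_mem_exteriorPower

theorem mul_mem_grading {m n : ℕ} {φ ψ : RothsteinAlgebra R A E}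
    (hφ : φ ∈ rothsteinGrading R A E m) (hψ : ψ ∈ rothsteinGrading R A E n) :
    φ * ψ ∈ rothsteinGrading R A E (m + n) := by
  refine grading_induction (C := fun φ => φ * ψ ∈ rothsteinGrading R A E (m + n))
    (by simp) (fun φ φ' h h' => by rw [add_mul]; exact add_mem h h')
    (fun p k hpk q hq ξ hξ => ?_) hφ
  refine grading_induction (C := fun ψ => (q ⊗ₜ[A] ξ) * ψ ∈ rothsteinGrading R A E (m + n))
    (by simp) (fun φ φ' h h' => by rw [mul_add]; exact add_mem h h')
    (fun p' k' hpk' q' hq' ξ' hξ' => ?_) hψ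
  rw [Algebra.TensorProduct.tmul_mul_tmul]
  refine tmul_mem_grading (p := p + p') (k := k + k') (by omega) ?_ ?_
  · rw [symPower, pow_add]; exact Submodule.mul_mem_mul hq hq'
  · rw [ExteriorAlgebra.exteriorPower, pow_add]; exact Submodule.mul_mem_mul hξ hξ'

theorem ofExterior_mul (ξ η : ExteriorAlgebra A E) :
    ofExterior R (ξ * η) = ofExterior R ξ * ofExterior R η := by
  simp [ofExterior]

theorem ofExterior_add (ξ η : ExteriorAlgebra A E) :
    ofExterior R (ξ + η) = ofExterior R ξ + ofExterior R η :=
  TensorProduct.tmul_add _ _ _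

theorem ofExterior_smul (c : A) (ξ : ExteriorAlgebra A E) :
    ofExterior R (c • ξ) = ofScalar R c * ofExterior R ξ := by
  rw [ofScalar_eq_right, ← ofExterior_mul, Algebra.smul_def]

theorem grading_hom_induction (C : ℕ → RothsteinAlgebra R A E → Prop) (zero : ∀ n, C n 0)
    (add : ∀ n φ ψ, C n φ → C n ψ → C n (φ + ψ)) (a : ∀ c, C 0 (ofScalar R c))
    (x : ∀ v, C 1 (ofModule R v)) (d : ∀ D, C 2 (ofDer E D))
    (mul : ∀ m n φ ψ, φ ∈ rothsteinGrading R A E m → ψ ∈ rothsteinGrading R A E n →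
      C m φ → C n ψ → C (m + n) (φ * ψ)) (n : ℕ) (φ : RothsteinAlgebra R A E)
    (hφ : φ ∈ rothsteinGrading R A E n) : C n φ := by
  refine grading_induction (zero n) (add n) (fun p k hpk q hq ξ hξ => ?_) hφ
  have h1 : C (2 * p) (q ⊗ₜ[A] 1) := by
    clear hpk
    induction hq using Submodule.pow_induction_on_left' with
    | algebraMap c => exact a c
    | add q q' i _ _ h h' => rw [TensorProduct.add_tmul]; exact add _ _ _ h h'
    | mem_mul q hq i q' hq' h =>
      obtain ⟨D, rfl⟩ := hq
      have := mul 2 (2 * i) _ _ (ofDer_mem D)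
        (tmul_mem_grading (p := i) (k := 0) (by ring) hq' one_mem_exteriorPower) (d D) h
      rw [ofDer, Algebra.TensorProduct.tmul_mul_tmul, one_mul] at this
      rwa [Nat.mul_succ, Nat.add_comm]
  have h2 : C k (ofExterior R ξ) := by
    clear hpk
    induction hξ using Submodule.pow_induction_on_left' with
    | algebraMap c => rw [← ofScalar_eq_right]; exact a c
    | add q q' i _ _ h h' => rw [ofExterior_add]; exact add _ _ _ h h'
    | mem_mul q hq i q' hq' h =>
      obtain ⟨v, rfl⟩ := hq
      rw [ofExterior_mul, Nat.succ_eq_add_one, Nat.add_comm]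
      exact mul 1 i _ _ (ofModule_mem v) (ofExterior_mem hq') (x v) h
  have := mul (2 * p) k _ _ (tmul_mem_grading (p := p) (k := 0) (by ring) hq one_mem_exteriorPower) (ofExterior_mem hξ) h1 h2
  rw [ofExterior, Algebra.TensorProduct.tmul_mul_tmul, one_mul, mul_one] at this
  rwa [← hpk]

theorem mem_iSup_grading (φ : RothsteinAlgebra R A E) : φ ∈ ⨆ n, rothsteinGrading R A E n := by
  have hmul : ∀ φ ψ : RothsteinAlgebra R A E, φ ∈ ⨆ n, rothsteinGrading R A E n →
      ψ ∈ ⨆ n, rothsteinGrading R A E n → φ * ψ ∈ ⨆ n, rothsteinGrading R A E n := by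
    intro φ ψ hφ hψ
    refine Submodule.iSup_induction _ (motive := fun φ => φ * ψ ∈ ⨆ n, rothsteinGrading R A E n)
      hφ (fun m φ hφ => ?_) (by simp) (fun φ φ' h h' => by rw [add_mul]; exact add_mem h h')
    refine Submodule.iSup_induction _ (motive := fun ψ => φ * ψ ∈ ⨆ n, rothsteinGrading R A E n)
      hψ (fun n ψ hψ => ?_) (by simp) (fun φ φ' h h' => by rw [mul_add]; exact add_mem h h')
    exact Submodule.mem_iSup_of_mem _ (mul_mem_grading hφ hψ)
  induction φ using TensorProduct.induction_on with
  | zero => exact zero_mem _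
  | add φ ψ h h' => exact add_mem h h'
  | tmul q ξ =>
    have h1 : q ⊗ₜ[A] 1 ∈ ⨆ n, rothsteinGrading R A E n := by
      induction q using SymmetricAlgebra.induction with
      | algebraMap c => exact Submodule.mem_iSup_of_mem 0 (ofScalar_mem c)
      | ι D => exact Submodule.mem_iSup_of_mem 2 (ofDer_mem D)
      | mul p q h h' => simpa using hmul _ _ h h'
      | add p q h h' => rw [TensorProduct.add_tmul]; exact add_mem h h'
    have h2 : ofExterior R ξ ∈ ⨆ n, rothsteinGrading R A E n := by
      induction ξ using ExteriorAlgebra.induction with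
      | algebraMap c =>
        rw [← ofScalar_eq_right]
        exact Submodule.mem_iSup_of_mem 0 (ofScalar_mem c)
      | ι v => exact Submodule.mem_iSup_of_mem 1 (ofModule_mem v)
      | mul p q h h' => rw [ofExterior_mul]; exact hmul _ _ h h'
      | add p q h h' => rw [ofExterior_add]; exact add_mem h h'
    simpa [ofExterior] using hmul _ _ h1 h2

theorem ofScalar_injective :
    Function.Injective (ofScalar R : A → RothsteinAlgebra R A E) := by
  -- The augmentation killing `Der` and `E` is a retraction onto `A`.
  let F : RothsteinAlgebra R A E →ₐ[A] A :=
    Algebra.TensorProduct.lift SymmetricAlgebra.algebraMapInv ExteriorAlgebra.algebraMapInv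
      fun _ _ => Commute.all _ _
  exact Function.LeftInverse.injective (g := F) fun c => F.commutes c

variable (R A E)

/-- The Rothstein algebra with its standard generators. -/
def presentation [Algebra ℚ R] : GradedPresentation R A E (RothsteinAlgebra R A E) where
  a := algebraMap A _
  x := AddMonoidHom.mk' (ofModule R) fun v w => by
    rw [ofModule, map_add, ofExterior_add]; rfl
  d := AddMonoidHom.mk' (ofDer E) fun D D' => by
    rw [ofDer, map_add, TensorProduct.add_tmul]; rfl
  j := AddMonoidHom.mk' (fun ω => ofExterior R (ω : ExteriorAlgebra A E)) fun ω ω' =>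
    ofExterior_add _ _
  G n := (rothsteinGrading R A E n).toAddSubgroup
  half := algebraMap R A (algebraMap ℚ R (1 / 2))
  half_add := by
    rw [← map_add, ← map_add, add_halves, map_one, map_one]
  a_injective := ofScalar_injective
  x_smul c v := by
    simp only [AddMonoidHom.mk'_apply, ofModule, map_smul]
    exact ofExterior_smul c _
  d_smul c D := by
    simp only [AddMonoidHom.mk'_apply, ofDer, map_smul]
    rw [← Algebra.smul_def]; rfl
  j_smul c ω := ofExterior_smul c _
  j_wedge v w := by
    simp [ofModule, ← ofExterior_mul, ExteriorAlgebra.ιMulti_apply]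
  a_central c φ := Algebra.commutes c φ
  d_central D φ := by
    induction φ using TensorProduct.induction_on with
    | zero => simp
    | add φ ψ h h' => rw [mul_add, add_mul, h, h']
    | tmul q ξ => simp [ofDer, mul_comm]
  x_sq v := by
    simp [ofModule, ← ofExterior_mul]
    simp [ofExterior]
  a_mem := ofScalar_mem
  x_mem := ofModule_mem
  d_mem := ofDer_mem
  mul_mem _ _ _ _ := mul_mem_grading
  hom_induction := grading_hom_induction
  sum_induction C add hC φ :=
    Submodule.iSup_induction _ (motive := C) (mem_iSup_grading φ) hC (hC 0 0 (zero_mem _)) add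
  exists_lift _ _ fa fx fd := exists_liftRingHom R A E fa fx fd

end Model

/-! ### The curvature 2-vector as a bilinear form on derivations. -/

section CurvedConnection

variable {R A E : Type*} [CommRing R] [Algebra ℚ R] [CommRing A] [Algebra R A]
    [AddCommGroup E] [Module A E] [Module.Finite A E] [Module.Projective A E]

theorem twoVector_ext {B : LinearMap.BilinForm A E} (h2 : IsUnit (2 : A)) (hB : B.IsSymm)
    (hnd : StronglyNondegenerate B) (ω : ⋀[A]^2 E) (h : ∀ v w, wedgePairing B ω v w = 0) :
    ω = 0 :=
  (existsUnique_twoVector h2 B hB hnd 0 (by simp)).unique (by simpa using h)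
    (by simp [wedgePairing])

/-- A metric connection with its curvature. -/
def curvedConnection (B : LinearMap.BilinForm A E) (hB : B.IsSymm)
    (hnd : StronglyNondegenerate B) (nabla : Connection R A E) (hm : nabla.IsMetric B) :
    CurvedConnection R A E := by
  have h2 : IsUnit (2 : A) := by
    simpa only [map_ofNat] using
      ((IsUnit.mk0 (2 : ℚ) two_ne_zero).map (algebraMap ℚ R)).map (algebraMap R A)
  -- Every property of `r` is transferred from the curvature operator through this uniqueness.
  have ext : ∀ ω ω' : ⋀[A]^2 E, (∀ v w, wedgePairing B ω v w = wedgePairing B ω' v w) →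
      ω = ω' := fun ω ω' h => by
    refine sub_eq_zero.1 (twoVector_ext h2 hB hnd _ fun v w => ?_)
    have e : ω - ω' = ω + (-1 : A) • ω' := by
      rw [sub_eq_add_neg]; exact congrArg _ (neg_one_smul A ω').symm
    rw [e, GradedPresentation.wedgePairing_add, GradedPresentation.wedgePairing_smul, h]
    ring
  have spec := curvatureTwoVector_spec B hB hnd nabla hm
  have neg : ∀ D D', curvatureTwoVector B hB hnd nabla hm D D' =
      -curvatureTwoVector B hB hnd nabla hm D' D := fun D D' => by
    refine ext _ _ fun v w => ?_
    have h : nabla.cov (-⁅D, D'⁆) v = -nabla.cov ⁅D, D'⁆ v := by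
      rw [← neg_one_smul A, nabla.smul_left, neg_one_smul]
    have h' : -curvatureTwoVector B hB hnd nabla hm D' D =
        (-1 : A) • curvatureTwoVector B hB hnd nabla hm D' D := (neg_one_smul A _).symm
    rw [h', GradedPresentation.wedgePairing_smul, spec, spec]
    simp only [Connection.curvature, LinearMap.coe_mk, AddHom.coe_mk, map_sub,
      LinearMap.sub_apply]
    rw [← lie_skew D' D, h, map_neg, LinearMap.neg_apply]
    ring
  have add : ∀ D D' D'', curvatureTwoVector B hB hnd nabla hm D (D' + D'') =
      curvatureTwoVector B hB hnd nabla hm D D' + curvatureTwoVector B hB hnd nabla hm D D'' :=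
    fun D D' D'' => by
      refine ext _ _ fun v w => ?_
      rw [GradedPresentation.wedgePairing_add, spec, spec, spec]
      simp only [Connection.curvature, LinearMap.coe_mk, AddHom.coe_mk, lie_add, map_sub, map_add,
        LinearMap.sub_apply, LinearMap.add_apply, nabla.add_left, nabla.add_right]
      ring
  exact
  { B := B
    symm := fun v w => hB.eq v w
    nondegenerate := fun v h => hnd.1 (by ext w; simpa using h w)
    nabla := nabla
    metric := hm
    r := AddMonoidHom.mk' (fun D => AddMonoidHom.mk' (curvatureTwoVector B hB hnd nabla hm D)
      (add D)) fun D D' => by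
        ext1 D''
        simp only [AddMonoidHom.mk'_apply, AddMonoidHom.add_apply]
        rw [neg, add, neg D, neg D', neg_add]
    r_smul := fun c D D' => by
      refine ext _ _ fun v w => ?_
      have : ⁅D, c • D'⁆ = c • ⁅D, D'⁆ + D c • D' := by
        ext c'
        simp only [Derivation.commutator_apply, Derivation.smul_apply, Derivation.add_apply,
          Derivation.leibniz, smul_eq_mul]
        ring
      rw [GradedPresentation.wedgePairing_smul]
      simp only [AddMonoidHom.mk'_apply, spec]
      simp only [Connection.curvature, LinearMap.coe_mk, AddHom.coe_mk, this, map_sub, map_add,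
        LinearMap.sub_apply, LinearMap.add_apply, nabla.add_left, nabla.smul_left, nabla.leibniz,
        map_smul, LinearMap.smul_apply, smul_eq_mul]
      ring
    r_neg := neg
    r_spec := spec
    wedge_ext := twoVector_ext h2 hB hnd }

end CurvedConnection

end Rothstein

end

/-! ### The theorem for the Rothstein algebra. -/

open Rothstein in
theorem mainTheorem2 {R A E : Type*} [CommRing R] [Algebra ℚ R] [CommRing A] [Algebra R A]
    [AddCommGroup E] [Module A E] [Module.Finite A E] [Module.Projective A E]
    (B : LinearMap.BilinForm A E) (hsymm : B.IsSymm)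
    (hnd : Rothstein.StronglyNondegenerate B) (hfull : Rothstein.IsFull B)
    (nabla : Rothstein.Connection R A E) (hmetric : nabla.IsMetric B) :
    ∃! br : Rothstein.RothsteinAlgebra R A E →ₗ[R]
        Rothstein.RothsteinAlgebra R A E →ₗ[R] Rothstein.RothsteinAlgebra R A E,
      Rothstein.IsGradedPoissonBracket (Rothstein.rothsteinGrading R A E) br ∧
      (∀ a b : A, br (Rothstein.ofScalar R a) (Rothstein.ofScalar R b) = 0) ∧
      (∀ (a : A) (x : E), br (Rothstein.ofScalar R a) (Rothstein.ofModule R x) = 0) ∧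
      (∀ x y : E, br (Rothstein.ofModule R x) (Rothstein.ofModule R y) =
        Rothstein.ofScalar R (B x y)) ∧
      (∀ (D : Derivation R A A) (a : A), br (Rothstein.ofDer E D) (Rothstein.ofScalar R a) =
        -Rothstein.ofScalar R (D a)) ∧
      (∀ (D : Derivation R A A) (x : E), br (Rothstein.ofDer E D) (Rothstein.ofModule R x) =
        -Rothstein.ofModule R (nabla.cov D x)) ∧
      (∀ D D' : Derivation R A A, br (Rothstein.ofDer E D) (Rothstein.ofDer E D') =
        -Rothstein.ofDer E ⁅D, D'⁆ -
          Rothstein.ofExterior R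
            (Rothstein.curvatureTwoVector B hsymm hnd nabla hmetric D D' :
              ExteriorAlgebra A E)) := by
  let S := presentation R A E
  let T := curvedConnection B hsymm hnd nabla hmetric
  have smul_eq : ∀ (r : R) (φ : RothsteinAlgebra R A E), r • φ = S.a (algebraMap R A r) * φ :=
    smul_eq_ofScalar_mul
  have hD : ∀ (r : R) (D : Derivation R A A), D (algebraMap R A r) = 0 := fun r D =>
    D.map_algebraMap r
  have tw_of_mem : ∀ {m n : ℕ} {φ : RothsteinAlgebra R A E}, φ ∈ rothsteinGrading R A E n →
      S.tw m.bodd φ = (-1) ^ (m * n) * φ := fun h => GradedPresentation.tw_of_mem (S := S) h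
  have par : ∀ {n : ℕ} {φ : RothsteinAlgebra R A E}, φ ∈ rothsteinGrading R A E n →
      S.Par n.bodd φ := fun h => S.par_of_mem h
  have sign_mul : ∀ (n : ℕ) (φ ψ : RothsteinAlgebra R A E),
      S.br T ((-1) ^ n * φ) ψ = (-1) ^ n * S.br T φ ψ := fun n φ ψ => by
    rcases neg_one_pow_eq_or (RothsteinAlgebra R A E) n with h | h <;> simp [h]
  let br : RothsteinAlgebra R A E →ₗ[R] RothsteinAlgebra R A E →ₗ[R] RothsteinAlgebra R A E :=
    LinearMap.mk₂ R (fun φ ψ => S.br T φ ψ) (fun φ φ' ψ => by simp)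
      (fun r φ ψ => by
        rw [smul_eq, smul_eq]; exact GradedPresentation.br_const_mul_left T (hD r) φ ψ)
      (fun φ ψ ψ' => by simp)
      (fun r φ ψ => by
        rw [smul_eq, smul_eq]; exact GradedPresentation.br_const_mul_right T (hD r) φ ψ)
  refine ⟨br, ⟨⟨?_, ?_, ?_, ?_, ?_⟩, ?_, ?_, ?_, ?_, ?_, ?_⟩, ?_⟩
  · intro r s t h φ hφ ψ hψ
    have key := S.br_mem T (m := r) (n := s) hφ hψ
    rw [show (r : ℤ) + s - 2 = (t : ℕ) by omega, GradedPresentation.GZ_natCast] at key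
    exact key
  · intro r s h φ hφ ψ hψ
    have key := S.br_mem T (m := r) (n := s) hφ hψ
    rw [GradedPresentation.GZ_neg (by omega), AddSubgroup.mem_bot] at key
    exact key
  · intro r s φ hφ ψ hψ
    have key := S.br_antisymm T (par hφ) ψ
    rw [tw_of_mem hψ, sign_mul] at key
    exact key
  · intro r s φ hφ ψ hψ χ
    have key := (par hφ).isDer_br T ψ χ
    rw [tw_of_mem hψ, mul_assoc] at key
    exact key
  · intro r s φ hφ ψ hψ χ
    have key := GradedPresentation.jac T (par hφ) (par hψ) χ
    rw [GradedPresentation.Jac, tw_of_mem hψ, sign_mul] at key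
    exact key
  · intro a b
    exact (DFunLike.congr_fun (S.br_a T a) _).trans (S.Xa_a a b)
  · intro a x
    exact (DFunLike.congr_fun (S.br_a T a) _).trans (S.Xa_x a x)
  · intro x y
    exact (DFunLike.congr_fun (S.br_x T x) _).trans (S.Xx_x T x y)
  · intro D a
    exact (DFunLike.congr_fun (S.br_d T D) _).trans (S.Xd_a T D a)
  · intro D x
    exact (DFunLike.congr_fun (S.br_d T D) _).trans (S.Xd_x T D x)
  · intro D D'
    exact (DFunLike.congr_fun (S.br_d T D) _).trans (S.Xd_d T D D')
  · rintro br' ⟨hP, aa, ax, xx, da, dx, dd⟩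
    have key := GradedPresentation.br_unique (S := S) T
      (AddMonoidHom.mk' (fun φ => (br' φ).toAddMonoidHom) fun φ φ' => by ext; simp)
      (fun m n φ ψ hφ hψ => hP.antisymm m n φ hφ ψ hψ)
      (fun m n φ ψ χ hφ hψ => hP.leibniz m n φ hφ ψ hψ χ) aa ax xx da dx dd
    ext1 φ
    ext1 ψ
    exact DFunLike.congr_fun (DFunLike.congr_fun key φ) ψ
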